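/- **Setting.** Let $N$ be a finite, linearly ordered ground set of size $n$, and let $f:2^N\to\mathbb R$ be monotone and submodular ($f(S\cup T)\le f(S)+f(T)-f(S\cap T)$) with $f(\emptyset)\ge 0$. A *consistent noisy oracle* for $f$ is $\tilde f(S)=\xi_S f(S)$, where the multipliers $(\xi_S)_{S\subseteq N}$ are i.i.d. with law $\mathcal D$, one multiplier per set. The law $\mathcal D$ is a probability measure on $\mathbb R$ that does not depend on $n$ and has a *generalized exponential tail*, that is, one of the following holds: * there is $x_0>0$ such that on $(x_0,\infty)$ the law has density $e^{-g(x)}$ with $g(x)=\sum_i a_i x^{\alpha_i}$ (a finite or convergent sum), where $\alpha_0>\alpha_1\ge\alpha_2\ge\dots$ are real, $\alpha_0\ge 1$ and $a_0>0$; or * $\mathcal D$ has bounded support and either has an atom at the supremum $b$ of the support, or has on some interval $(c,b]$ a density that is (left-)continuous and non-zero at $b$. Moreover, either $\mathcal D$ is supported on $[0,\infty)$ and is not the point mass at $0$, or $\mathcal D$ is Gaussian with positive mean. Logarithms are to base $2$. **Algorithm (Slick-Greedy, budget $k$, accuracy $0<\varepsilon\le 1$).** Let $m=\lceil 6/\varepsilon\rceil$.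 Let $\ell=\lceil 25\log n\rceil$ if $k\ge 2400\log n/\varepsilon^2$, and $\ell=\lceil 33\log\log n\rceil$ otherwise. Take arbitrary pairwise disjoint sets $H_1,\dots,H_m\subseteq N$ of size $\ell$. * *Smooth-Greedy.* For each $j$ let $R_j=\bigcup_{i\ne j}H_i$. Starting from $S=R_j$, perform $k-|R_j|-|H_j|$ times: add to $S$ the element $a\notin S\cup H_j$ (the first one in case of ties) that maximizes the noisy smooth value $2^{-\ell}\sum_{X\subseteq H_j}\tilde f(S\cup X\cup\{a\})$. Let $S_j$ be the resulting set and $T_j=S_j\cup H_j$. * *Smooth-Compare.* To compare $T$ with $U$, take an arbitrary set $C=C(T,U)$ of $\ell$ elements disjoint from $T\cup U$. For every $X\subseteq C$ the set $T$ wins the comparison at $X$ if $\tilde f(T\cup X)\ge\tilde f(U\cup X)$, and $U$ wins it if $\tilde f(U\cup X)\ge\tilde f(T\cup X)$ (both win if the values are equal). Return the set with more wins; equal numbers of wins are resolved lexicographically. * *Tournament.* Start with $T_1$ as current winner, and compare the current winner with $T_2,\dots,T_m$ in turn. Return the final winner $T$. The algorithm is deterministic given the oracle, and it needs the comparison sets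 to exist. We say that *there is room* if $|N\setminus(T_i\cup T_j)|\ge\ell$ for all $i,j$ with $T_i\neq T_j$. **Theorem (Slick-Greedy).** For every fixed $\varepsilon\in(0,1]$ and every law $\mathcal D$ as above there is $n_0$ such that the following holds for all $n\ge n_0$, all $k\ge 3168\,\log\log n/\varepsilon^2$, all $f$ as above, all choices of the sets $H_j$ and of the rule $C$. With probability at least $1-1/n$ over the noise, if there is room, then the set $T$ returned by Slick-Greedy satisfies $|T|\le k$ and $$f(T)\ \ge\ \Bigl(1-\frac1e-\varepsilon\Bigr)\max_{|S|\le k}f(S).$$ Moreover, if $2k\le n$, then there is always room, whatever the noise is. -/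

import Mathlib

open Finset MeasureTheory ProbabilityTheory
open scoped NNReal ENNReal

noncomputable section

namespace NoisySubmodular

/-- A set function is submodular if `f (S ∪ T) ≤ f S + f T - f (S ∩ T)` for all `S`, `T`. -/
def IsSubmodular {N : Type*} [DecidableEq N] (f : Finset N → ℝ) : Prop :=
  ∀ S T : Finset N, f (S ∪ T) ≤ f S + f T - f (S ∩ T)

/-- The optimal value `max_{|S| ≤ k} f S`. -/
def optValue {N : Type*} [Fintype N] (f : Finset N → ℝ) (k : ℕ) : ℝ :=
  (univ.filter (fun S : Finset N => #S ≤ k)).sup' ⟨∅, by simp⟩ f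

/-! ### Noise -/

/-- The upper tail of `D` has a density `exp (-g x)` on some half line, where
`g x = ∑ i, a i * x ^ α i` with non-increasing real exponents, leading exponent at least `1`.
Like powers are merged (`α 1 < α 0`), so that `a 0` really is the leading coefficient; it is
positive.  A finite sum is the case in which `a` is eventually zero. -/
def HasExponentialUpperTail (D : Measure ℝ) : Prop :=
  ∃ (x₀ : ℝ) (a α : ℕ → ℝ) (g : ℝ → ℝ),
    0 < x₀ ∧ Antitone α ∧ 1 ≤ α 0 ∧ α 1 < α 0 ∧ 0 < a 0 ∧
    (∀ x, x₀ < x → HasSum (fun i => a i * x ^ α i) (g x)) ∧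
    D.restrict (Set.Ioi x₀) =
      (volume.restrict (Set.Ioi x₀)).withDensity (fun x => ENNReal.ofReal (Real.exp (-g x)))

/-- `D` has bounded support, and at the supremum `b` of the support it either has an atom or has
(to the left of `b`) a density that is continuous and non-zero at `b`. -/
def HasBoundedTail (D : Measure ℝ) : Prop :=
  ∃ a b : ℝ, D (Set.Icc a b)ᶜ = 0 ∧
    (0 < D {b} ∨
      ∃ (c : ℝ) (p : ℝ → ℝ), c < b ∧ Measurable p ∧
        D.restrict (Set.Ioc c b) =
          (volume.restrict (Set.Ioc c b)).withDensity (fun x => ENNReal.ofReal (p x)) ∧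
        ContinuousWithinAt p (Set.Iic b) b ∧ 0 < p b)

/-- Generalized exponential tail distributions. -/
def HasGeneralizedExponentialTail (D : Measure ℝ) : Prop :=
  HasExponentialUpperTail D ∨ HasBoundedTail D

/-- Distributions of noise multipliers: non-negative and not identically zero, or Gaussian with
positive mean. -/
def IsMultiplierLaw (D : Measure ℝ) : Prop :=
  ((∀ᵐ x ∂D, 0 ≤ x) ∧ ¬ (∀ᵐ x ∂D, x = 0)) ∨
    ∃ (m : ℝ) (v : ℝ≥0), 0 < m ∧ D = gaussianReal m v

/-- The consistent noisy oracle: one multiplier `ξ S` for every set `S`. -/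
def noisyOracle {N : Type*} (f : Finset N → ℝ) (ξ : Finset N → ℝ) : Finset N → ℝ :=
  fun S => ξ S * f S

/-- The joint law of the multipliers: independent for different sets, each with law `D`. -/
def noiseLaw (N : Type*) [Fintype N] (D : Measure ℝ) : Measure (Finset N → ℝ) :=
  Measure.pi (fun _ : Finset N => D)

/-! ### The algorithm

In this part `q : Finset N → ℝ` is the oracle that the algorithm queries. -/

section Algorithm

variable {N : Type*} [Fintype N] [LinearOrder N]

/-- The (noisy) smooth value of `S ∪ {a}` for the smoothing set `H`: the average of
`q (S ∪ (X ∪ {a}))` over all `X ⊆ H`. -/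
def smoothValue (q : Finset N → ℝ) (H S : Finset N) (a : N) : ℝ :=
  (1 / 2 ^ #H) * ∑ X ∈ H.powerset, q (S ∪ (X ∪ {a}))

/-- The elements outside `H ∪ S` of largest smooth value. -/
def argmaxSet (q : Finset N → ℝ) (H S : Finset N) : Finset N :=
  (H ∪ S)ᶜ.filter (fun a => ∀ b ∈ (H ∪ S)ᶜ, smoothValue q H S b ≤ smoothValue q H S a)

/-- One iteration of Smooth-Greedy: add an element of largest smooth value, the first such
element if there are several (and nothing if no element is left). -/
def greedyStep (q : Finset N → ℝ) (H S : Finset N) : Finset N :=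
  if h : (argmaxSet q H S).Nonempty then insert ((argmaxSet q H S).min' h) S else S

/-- Smooth-Greedy with budget `k`, initialized with `R`, with smoothing set `H`: starting from
`S = R` it adds `k - |R| - |H|` elements. -/
def smoothGreedy (q : Finset N → ℝ) (k : ℕ) (R H : Finset N) : Finset N :=
  (greedyStep q H)^[k - #R - #H] R

/-- The number of `X ⊆ C` for which `q (T ∪ X) ≥ q (U ∪ X)`. -/
def wins (q : Finset N → ℝ) (T U C : Finset N) : ℕ :=
  #(C.powerset.filter (fun X => q (U ∪ X) ≤ q (T ∪ X)))

/-- Smooth-Compare: return whichever of `T`, `U` wins more of the comparisons of `q (T ∪ X)` with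
`q (U ∪ X)`, `X ⊆ C` (a comparison with equal values counts for both); equal numbers of wins are
resolved by the lexicographic order of the sorted sets. -/
def smoothCompare (q : Finset N → ℝ) (T U C : Finset N) : Finset N :=
  if wins q U T C < wins q T U C ∨
      (wins q T U C = wins q U T C ∧ T.sort (· ≤ ·) ≤ U.sort (· ≤ ·))
  then T else U

/-- The candidate `T_j = Smooth-Greedy (k, R_j, H_j) ∪ H_j`, where `R_j` is the union of the
`H_i` with `i ≠ j`. -/
def candidate (q : Finset N → ℝ) (k : ℕ) {m : ℕ} (H : Fin m → Finset N) (j : Fin m) : Finset N :=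
  smoothGreedy q k ((univ.erase j).biUnion H) (H j) ∪ H j

/-- The tournament: the current winner `T` meets the remaining sets one after the other; the
comparison of `T` with `U` uses the comparison set `C T U`. -/
def tournament (q : Finset N → ℝ) (C : Finset N → Finset N → Finset N) :
    Finset N → List (Finset N) → Finset N
  | T, [] => T
  | T, U :: L => tournament q C (smoothCompare q T U (C T U)) L

/-- Slick-Greedy with budget `k`, smoothing sets `H 0, …, H (m - 1)` and comparison sets given by
the rule `C`: the winner of the tournament of the candidates. -/
def slickGreedy (q : Finset N → ℝ) (k : ℕ) {m : ℕ} (H : Fin m → Finset N)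
    (C : Finset N → Finset N → Finset N) : Finset N :=
  match List.ofFn (candidate q k H) with
  | [] => ∅
  | T :: L => tournament q C T L

/-- Any two different candidates leave at least `l` elements of the ground set uncovered, so that
the comparison sets of size `l` that the algorithm asks for exist. -/
def HasComparisonRoom (q : Finset N → ℝ) (k l : ℕ) {m : ℕ} (H : Fin m → Finset N) : Prop :=
  ∀ i j : Fin m, candidate q k H i ≠ candidate q k H j →
    l ≤ #(candidate q k H i ∪ candidate q k H j)ᶜ

end Algorithm

/-- The number `1 / δ` of smoothing sets, with `δ = ε / 6`, rounded up. -/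
def numSets (ε : ℝ) : ℕ := ⌈6 / ε⌉₊

/-- The size `ℓ` of the smoothing sets (rounded up): `25 log n` if `k ≥ 2400 log n / ε ^ 2`, and
`33 log log n` otherwise; logarithms are to base `2`. -/
def smoothingSize (ε : ℝ) (n k : ℕ) : ℕ :=
  if 2400 * Real.logb 2 n / ε ^ 2 ≤ k then ⌈25 * Real.logb 2 n⌉₊
  else ⌈33 * Real.logb 2 (Real.logb 2 n)⌉₊

end NoisySubmodular

end

/-!
Averaging the oracle over the `2 ^ ℓ` sets `S ∪ X`, `X ⊆ H`, averages `2 ^ ℓ` independent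
multipliers. Laws with a generalized exponential tail have exponential moments, so by a Chernoff
bound and a union bound over the at most `(n + 1) ^ k` sets `S`, all smooth values of sets of size
at most `k` are, up to the mean of the multipliers, the averages of `f (S ∪ X)` with an error that
is a small multiple of `OPT / k`. These averages are again a monotone submodular function of `S`,
so greedy on them loses only a factor `1 - 1 / e`. What the smoothing set `H j` itself contributes
is at most `OPT / m` for some `j`, by submodularity.

The tournament must not lose this good candidate. Multiplying two values whose ratio is bounded
away from `1` by independent multipliers favors the larger one by a fixed margin, and the `2 ^ ℓ`
comparisons of `T ∪ X` with `U ∪ X` use disjoint pairs of multipliers, so by Hoeffding's inequality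
the majority is right for all pairs of sets at once. Adding `ℓ` fresh elements to a candidate
increases `f` only slightly since greedy would otherwise have taken them, so the values at `X`
compare like `f T` and `f U`, and each of the `m - 1` comparisons loses a small fraction of `OPT`.
-/

namespace NoisySubmodular

section Submodular

variable {N : Type*} [DecidableEq N] {f : Finset N → ℝ}

theorem IsSubmodular.union_sub_le (hf : IsSubmodular f) (hm : Monotone f) {S T : Finset N}
    (hST : S ⊆ T) (A : Finset N) : f (T ∪ A) - f T ≤ f (S ∪ A) - f S := by
  have hsub := hf (S ∪ A) T
  have hunion : S ∪ A ∪ T = T ∪ A := by rw [union_right_comm, union_eq_right.2 hST]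
  have hinter : f S ≤ f ((S ∪ A) ∩ T) := hm (subset_inter subset_union_left hST)
  rw [hunion] at hsub
  linarith

theorem IsSubmodular.insert_sub_le (hf : IsSubmodular f) (hm : Monotone f) {S T : Finset N}
    (hST : S ⊆ T) (a : N) : f (insert a T) - f T ≤ f (insert a S) - f S := by
  simpa only [union_singleton] using hf.union_sub_le hm hST {a}

theorem IsSubmodular.union_sub_le_sum (hf : IsSubmodular f) (hm : Monotone f) (S O : Finset N) :
    f (S ∪ O) - f S ≤ ∑ b ∈ O, (f (insert b S) - f S) := by
  induction O using Finset.induction_on with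
  | empty => simp
  | insert b O hb ih =>
    rw [sum_insert hb, union_insert]
    linarith [hf.insert_sub_le hm (subset_union_left : S ⊆ S ∪ O) b]

theorem biUnion_erase_union_of_mem {ι : Type*} [DecidableEq ι] {I : Finset ι} {j : ι} (hj : j ∈ I)
    (H : ι → Finset N) : (I.erase j).biUnion H ∪ H j = I.biUnion H := by
  conv_rhs => rw [← insert_erase hj, biUnion_insert, union_comm]

theorem IsSubmodular.sum_sub_erase_le (hf : IsSubmodular f) (hm : Monotone f) {ι : Type*}
    [DecidableEq ι] (I : Finset ι) (H : ι → Finset N) :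
    ∑ j ∈ I, (f (I.biUnion H) - f ((I.erase j).biUnion H)) ≤ f (I.biUnion H) - f ∅ := by
  induction I using Finset.induction_on with
  | empty => simp
  | insert i I hi ih =>
    have loss_le : ∀ j ∈ I,
        f ((insert i I).biUnion H) - f (((insert i I).erase j).biUnion H) ≤
          f (I.biUnion H) - f ((I.erase j).biUnion H) := by
      intro j hj
      have h := hf.union_sub_le hm (biUnion_subset_biUnion_of_subset_left H
        (erase_subset_erase j (subset_insert i I))) (H j)
      rwa [biUnion_erase_union_of_mem (mem_insert_of_mem hj), biUnion_erase_union_of_mem hj] at h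
    rw [sum_insert hi, erase_insert hi]
    linarith [sum_le_sum loss_le]

end Submodular

section SmoothAvg

variable {N : Type*} [DecidableEq N] {f : Finset N → ℝ}

/-- The smoothing of `f` by `H`: the average of `f (S ∪ X)` over all `X ⊆ H`. The smooth value of
`S ∪ {a}` that the algorithm maximizes is the smoothing of the oracle at `insert a S`. -/
noncomputable def smoothAvg (f : Finset N → ℝ) (H S : Finset N) : ℝ :=
  (1 / 2 ^ #H) * ∑ X ∈ H.powerset, f (S ∪ X)

theorem smoothAvg_const (c : ℝ) (H S : Finset N) : smoothAvg (fun _ => c) H S = c := by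
  simp [smoothAvg]

theorem smoothAvg_le_smoothAvg {g h : Finset N → ℝ} {H S T : Finset N}
    (hgh : ∀ X ⊆ H, g (S ∪ X) ≤ h (T ∪ X)) : smoothAvg g H S ≤ smoothAvg h H T :=
  mul_le_mul_of_nonneg_left (sum_le_sum fun X hX => hgh X (mem_powerset.1 hX)) (by positivity)

theorem monotone_smoothAvg (hm : Monotone f) (H : Finset N) : Monotone (smoothAvg f H) :=
  fun _ _ h => smoothAvg_le_smoothAvg fun _ _ => hm (union_subset_union_left h)

theorem le_smoothAvg (hm : Monotone f) (H S : Finset N) : f S ≤ smoothAvg f H S := by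
  rw [← smoothAvg_const (f S) H S]
  exact smoothAvg_le_smoothAvg fun _ _ => hm subset_union_left

theorem smoothAvg_le (hm : Monotone f) (H S : Finset N) : smoothAvg f H S ≤ f (S ∪ H) := by
  rw [← smoothAvg_const (f (S ∪ H)) H S]
  exact smoothAvg_le_smoothAvg fun _ hX => hm (union_subset_union_right hX)

theorem IsSubmodular.smoothAvg (hf : IsSubmodular f) (H : Finset N) :
    IsSubmodular (smoothAvg f H) := by
  intro S T
  unfold NoisySubmodular.smoothAvg
  rw [← mul_add, ← mul_sub, ← sum_add_distrib, ← sum_sub_distrib]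
  refine mul_le_mul_of_nonneg_left (sum_le_sum fun X _ => ?_) (by positivity)
  have h := hf (S ∪ X) (T ∪ X)
  rwa [← inter_union_distrib_right, ← union_union_distrib_right] at h

theorem IsSubmodular.union_sub_le_smoothAvg_sub (hf : IsSubmodular f) (hm : Monotone f)
    (H S A : Finset N) :
    f (S ∪ H ∪ A) - f (S ∪ H) ≤
      NoisySubmodular.smoothAvg f H (S ∪ A) - NoisySubmodular.smoothAvg f H S := by
  rw [← smoothAvg_const (f (S ∪ H ∪ A) - f (S ∪ H)) H S]
  unfold NoisySubmodular.smoothAvg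
  rw [← mul_sub, ← sum_sub_distrib]
  refine mul_le_mul_of_nonneg_left (sum_le_sum fun X hX => ?_) (by positivity)
  have h := hf.union_sub_le hm (union_subset_union_right (mem_powerset.1 hX) : S ∪ X ⊆ S ∪ H) A
  rwa [union_right_comm S X A] at h

end SmoothAvg

section ApproxGreedy

variable {N : Type*} [DecidableEq N] {f : Finset N → ℝ}

/-- The first `K` steps of the sequence `S` are greedy up to `e`: each of them leads at least to
the value, up to `e`, that adding any single element of `A` would give. -/
def IsApproxGreedy (f : Finset N → ℝ) (S : ℕ → Finset N) (A : Finset N) (e : ℝ) (K : ℕ) : Prop :=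
  ∀ i < K, ∀ b ∈ A, f (insert b (S i)) ≤ f (S (i + 1)) + e

theorem IsSubmodular.union_sub_le_card_mul (hf : IsSubmodular f) (hm : Monotone f)
    {S O : Finset N} {v : ℝ} {k : ℕ} (hv : f S ≤ v) (hO : ∀ b ∈ O, f (insert b S) ≤ v)
    (hk : #O ≤ k) : f (S ∪ O) - f S ≤ k * (v - f S) :=
  calc f (S ∪ O) - f S ≤ ∑ b ∈ O, (f (insert b S) - f S) := hf.union_sub_le_sum hm S O
    _ ≤ ∑ _b ∈ O, (v - f S) := sum_le_sum fun b hb => sub_le_sub_right (hO b hb) _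
    _ = #O * (v - f S) := by rw [sum_const, nsmul_eq_mul]
    _ ≤ k * (v - f S) := by gcongr

variable {S : ℕ → Finset N} {A : Finset N} {e : ℝ} {K : ℕ}

theorem IsApproxGreedy.sub_le_pow_mul (h : IsApproxGreedy f S A e K) (hf : IsSubmodular f)
    (hm : Monotone f) (hS : Monotone S) (he : 0 ≤ e) {O : Finset N} (hOA : O ⊆ A) {k : ℕ}
    (hk : 0 < k) (hOk : #O ≤ k) :
    f (S 0 ∪ O) - f (S K) ≤ (1 - 1 / (k : ℝ)) ^ K * (f (S 0 ∪ O) - f (S 0)) + K * e := by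
  set V := f (S 0 ∪ O)
  have hkR : (0 : ℝ) < k := by exact_mod_cast hk
  have hk_inv : 1 / (k : ℝ) ≤ 1 := by rw [div_le_one hkR]; exact_mod_cast hk
  induction K with
  | zero => simp
  | succ K ih =>
    have gap_le : V - f (S K) ≤ k * (f (S (K + 1)) + e - f (S K)) := by
      have hV : V ≤ f (S K ∪ O) := hm (union_subset_union_left (hS K.zero_le))
      have hstep := hf.union_sub_le_card_mul hm (v := f (S (K + 1)) + e)
        (by linarith [hm (hS K.le_succ)]) (fun b hb => h K K.lt_succ_self b (hOA hb)) hOk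
      linarith
    have contraction : V - f (S (K + 1)) ≤ (1 - 1 / (k : ℝ)) * (V - f (S K)) + e := by
      have : (1 / (k : ℝ)) * (V - f (S K)) ≤ f (S (K + 1)) + e - f (S K) := by
        rwa [div_mul_eq_mul_div, one_mul, div_le_iff₀' hkR]
      linarith
    calc V - f (S (K + 1)) ≤ (1 - 1 / (k : ℝ)) * (V - f (S K)) + e := contraction
      _ ≤ (1 - 1 / (k : ℝ)) * ((1 - 1 / (k : ℝ)) ^ K * (V - f (S 0)) + K * e) + e := by
          gcongr
          exact ih fun i hi => h i (hi.trans K.lt_succ_self)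
      _ ≤ (1 - 1 / (k : ℝ)) ^ (K + 1) * (V - f (S 0)) + (K + 1 : ℕ) * e := by
          have : 0 ≤ 1 / (k : ℝ) * (K * e) := by positivity
          rw [pow_succ']
          push_cast
          linarith

theorem IsApproxGreedy.mul_insert_sub_le (h : IsApproxGreedy f S A e K) (hf : IsSubmodular f)
    (hm : Monotone f) (hS : Monotone S) {c : N} (hc : c ∈ A) :
    K * (f (insert c (S K)) - f (S K)) ≤ f (S K) - f (S 0) + K * e := by
  have step_le : ∀ i ∈ range K,
      f (insert c (S K)) - f (S K) ≤ f (S (i + 1)) - f (S i) + e := by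
    intro i hi
    have hiK := mem_range.1 hi
    linarith [hf.insert_sub_le hm (hS hiK.le) c, h i hiK c hc]
  have hsum := sum_le_sum step_le
  rwa [sum_add_distrib, sum_range_sub (fun i => f (S i)), sum_const, sum_const, card_range,
    nsmul_eq_mul, nsmul_eq_mul] at hsum

end ApproxGreedy

section Families

variable {N : Type*} [DecidableEq N] {m l : ℕ} {H : Fin m → Finset N}

/-- The sets `H j` can serve as the smoothing sets of Slick-Greedy: they are pairwise disjoint and
have `l` elements each. -/
structure IsSmoothingFamily (H : Fin m → Finset N) (l : ℕ) : Prop where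
  card_eq : ∀ j, #(H j) = l
  disjoint : ∀ i j, i ≠ j → Disjoint (H i) (H j)

theorem IsSmoothingFamily.disjoint_biUnion_erase (hH : IsSmoothingFamily H l) (j : Fin m) :
    Disjoint ((univ.erase j).biUnion H) (H j) :=
  (disjoint_biUnion_left _ _ _).2 fun i hi => hH.disjoint i j (mem_erase.1 hi).1

theorem IsSmoothingFamily.card_biUnion (hH : IsSmoothingFamily H l) :
    #(univ.biUnion H) = m * l := by
  rw [Finset.card_biUnion fun i _ j _ => hH.disjoint i j]
  simp [hH.card_eq]

theorem IsSmoothingFamily.card_biUnion_erase_add (hH : IsSmoothingFamily H l) (j : Fin m) :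
    #((univ.erase j).biUnion H) + #(H j) = m * l := by
  rw [← card_union_of_disjoint (hH.disjoint_biUnion_erase j),
    biUnion_erase_union_of_mem (mem_univ j), hH.card_biUnion]

end Families

section OptValue

variable {N : Type*} [Fintype N] {k : ℕ}

theorem le_optValue (f : Finset N → ℝ) {S : Finset N} (hS : #S ≤ k) : f S ≤ optValue f k :=
  le_sup' f (mem_filter.2 ⟨mem_univ S, hS⟩)

theorem exists_eq_optValue (f : Finset N → ℝ) (k : ℕ) : ∃ O, #O ≤ k ∧ f O = optValue f k := by
  obtain ⟨O, hO, h⟩ := exists_mem_eq_sup' (s := univ.filter fun S : Finset N => #S ≤ k)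
    ⟨∅, by simp⟩ f
  exact ⟨O, (mem_filter.1 hO).2, h.symm⟩

theorem mul_optValue_le_of_nonpos {f : Finset N → ℝ} (hm : Monotone f) (h0 : 0 ≤ f ∅)
    (hW : optValue f k ≤ 0) (c : ℝ) (T : Finset N) : c * optValue f k ≤ f T := by
  have hW0 : 0 ≤ optValue f k := h0.trans (le_optValue f (by simp))
  rw [le_antisymm hW hW0, mul_zero]
  exact h0.trans (hm (empty_subset T))

end OptValue

section SmoothGreedy

variable {N : Type*} [LinearOrder N]

theorem smoothValue_eq_smoothAvg (q : Finset N → ℝ) (H S : Finset N) (a : N) :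
    smoothValue q H S a = smoothAvg q H (insert a S) := by
  have hunion : ∀ X : Finset N, S ∪ (X ∪ {a}) = insert a S ∪ X := fun X => by
    rw [← union_assoc, union_singleton, insert_union]
  simp only [smoothValue, smoothAvg, hunion]

variable [Fintype N]

theorem greedyStep_cases (q : Finset N → ℝ) (H S : Finset N) :
    (H ∪ S = univ ∧ greedyStep q H S = S) ∨
      ∃ a ∉ H ∪ S, greedyStep q H S = insert a S ∧
        ∀ b ∉ H ∪ S, smoothAvg q H (insert b S) ≤ smoothAvg q H (insert a S) := by
  by_cases hne : (argmaxSet q H S).Nonempty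
  · obtain ⟨hmem, hmax⟩ := mem_filter.1 (min'_mem _ hne)
    refine Or.inr ⟨_, mem_compl.1 hmem, by rw [greedyStep, dif_pos hne], fun b hb => ?_⟩
    simpa only [smoothValue_eq_smoothAvg] using hmax b (mem_compl.2 hb)
  · refine Or.inl ⟨?_, by rw [greedyStep, dif_neg hne]⟩
    by_contra hcover
    obtain ⟨a, ha, hmax⟩ := exists_max_image (H ∪ S)ᶜ (smoothValue q H S)
      (nonempty_iff_ne_empty.2 fun h => hcover (compl_eq_empty_iff _ |>.1 h))
    exact hne ⟨a, mem_filter.2 ⟨ha, hmax⟩⟩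

theorem subset_greedyStep (q : Finset N → ℝ) (H S : Finset N) : S ⊆ greedyStep q H S := by
  rcases greedyStep_cases q H S with ⟨_, h⟩ | ⟨a, _, h, _⟩ <;> rw [h]
  exact subset_insert a S

theorem monotone_iterate_greedyStep (q : Finset N → ℝ) (H R : Finset N) :
    Monotone fun i => (greedyStep q H)^[i] R :=
  monotone_nat_of_le_succ fun i => by
    rw [Function.iterate_succ_apply']
    exact subset_greedyStep q H _

theorem disjoint_iterate_greedyStep (q : Finset N → ℝ) {R H : Finset N} (hRH : Disjoint R H)
    (i : ℕ) : Disjoint ((greedyStep q H)^[i] R) H := by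
  induction i with
  | zero => exact hRH
  | succ i ih =>
    rw [Function.iterate_succ_apply']
    rcases greedyStep_cases q H ((greedyStep q H)^[i] R) with ⟨_, h⟩ | ⟨a, ha, h, _⟩ <;> rw [h]
    · exact ih
    · exact disjoint_insert_left.2 ⟨fun haH => ha (mem_union_left _ haH), ih⟩

theorem card_iterate_greedyStep_le (q : Finset N → ℝ) (H R : Finset N) (i : ℕ) :
    #((greedyStep q H)^[i] R) ≤ #R + i := by
  induction i with
  | zero => simp
  | succ i ih =>
    rw [Function.iterate_succ_apply']
    rcases greedyStep_cases q H ((greedyStep q H)^[i] R) with ⟨_, h⟩ | ⟨a, _, h, _⟩ <;> rw [h]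
    · exact ih.trans (by simp)
    · exact (card_insert_le _ _).trans (by omega)

theorem union_iterate_greedyStep_eq_univ_or_card_eq (q : Finset N → ℝ) (H R : Finset N) (i : ℕ) :
    H ∪ (greedyStep q H)^[i] R = univ ∨ #((greedyStep q H)^[i] R) = #R + i := by
  induction i with
  | zero => simp
  | succ i ih =>
    rw [Function.iterate_succ_apply']
    rcases greedyStep_cases q H ((greedyStep q H)^[i] R) with ⟨hcover, h⟩ | ⟨a, ha, h, _⟩ <;> rw [h]
    · exact Or.inl hcover
    · have hcard := ih.resolve_left fun hcover => ha (hcover ▸ mem_univ a)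
      right
      rw [card_insert_of_notMem fun haS => ha (mem_union_right _ haS), hcard, add_assoc]

theorem card_smoothGreedy_union_le (q : Finset N → ℝ) {k : ℕ} {R H : Finset N}
    (hk : #R + #H ≤ k) : #(smoothGreedy q k R H ∪ H) ≤ k := by
  have hunion := card_union_le (smoothGreedy q k R H) H
  have hgreedy : #(smoothGreedy q k R H) ≤ _ := card_iterate_greedyStep_le q H R _
  omega

theorem smoothGreedy_union_eq_univ (q : Finset N → ℝ) {k : ℕ} {R H : Finset N}
    (hRH : Disjoint R H) (hk : #R + #H ≤ k) (hN : Fintype.card N ≤ k) :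
    smoothGreedy q k R H ∪ H = univ := by
  rcases union_iterate_greedyStep_eq_univ_or_card_eq q H R (k - #R - #H) with hcover | hcard
  · rwa [smoothGreedy, union_comm]
  · refine eq_univ_of_card _ (le_antisymm (card_le_univ _) ?_)
    rw [smoothGreedy, card_union_of_disjoint (disjoint_iterate_greedyStep q hRH _), hcard]
    omega

/-- The smoothed values of the oracle `q` are reliable: for all sets that have at most `k` elements
together with `H` they differ from `μ` times those of `f` by at most `μ * t`. Here `μ` is the mean
of the noise multipliers. -/
def SmoothClose (q f : Finset N → ℝ) (μ t : ℝ) (k : ℕ) (H : Finset N) : Prop :=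
  ∀ V : Finset N, Disjoint V H → #(V ∪ H) ≤ k →
    |smoothAvg q H V - μ * smoothAvg f H V| ≤ μ * t

variable {q f : Finset N → ℝ} {μ t : ℝ} {k : ℕ} {R H S : Finset N}

theorem SmoothClose.smoothAvg_insert_le_greedyStep (h : SmoothClose q f μ t k H) (hμ : 0 < μ)
    (ht : 0 ≤ t) (hm : Monotone f) (hS : Disjoint S H) (hk : #S + #H < k) {b : N} (hb : b ∉ H) :
    smoothAvg f H (insert b S) ≤ smoothAvg f H (greedyStep q H S) + 2 * t := by
  by_cases hbS : b ∈ S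
  · rw [insert_eq_of_mem hbS]
    linarith [monotone_smoothAvg hm H (subset_greedyStep q H S)]
  have hbHS : b ∉ H ∪ S := by simp only [mem_union, hb, hbS, or_self, not_false_eq_true]
  rcases greedyStep_cases q H S with ⟨hcover, -⟩ | ⟨a, ha, hstep, hmax⟩
  · exact absurd (hcover ▸ mem_univ b) hbHS
  have insert_close : ∀ c ∉ H,
      |smoothAvg q H (insert c S) - μ * smoothAvg f H (insert c S)| ≤ μ * t := fun c hc =>
    h _ (disjoint_insert_left.2 ⟨hc, hS⟩) <| (card_union_le _ _).trans <| by
      have := card_insert_le c S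
      omega
  have hclose_a := abs_le.1 (insert_close a fun haH => ha (mem_union_left _ haH))
  have hclose_b := abs_le.1 (insert_close b hb)
  rw [hstep]
  refine le_of_mul_le_mul_left ?_ hμ
  linarith [hclose_a.2, hclose_b.1, hmax b hbHS]

theorem SmoothClose.isApproxGreedy (h : SmoothClose q f μ t k H) (hμ : 0 < μ) (ht : 0 ≤ t)
    (hm : Monotone f) (hRH : Disjoint R H) :
    IsApproxGreedy (smoothAvg f H) (fun i => (greedyStep q H)^[i] R) Hᶜ (2 * t)
      (k - #R - #H) := by
  intro i hi b hb
  have hcard := card_iterate_greedyStep_le q H R i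
  beta_reduce
  rw [Function.iterate_succ_apply']
  exact h.smoothAvg_insert_le_greedyStep hμ ht hm (disjoint_iterate_greedyStep q hRH i) (by omega)
    (mem_compl.1 hb)

theorem SmoothClose.mul_union_sub_le (h : SmoothClose q f μ t k H) (hμ : 0 < μ) (ht : 0 ≤ t)
    (hf : IsSubmodular f) (hm : Monotone f) (h0 : 0 ≤ f ∅) (hRH : Disjoint R H)
    (hk : #R + #H ≤ k) {X : Finset N} (hX : Disjoint X H) :
    (k - #R - #H : ℕ) * (f (smoothGreedy q k R H ∪ H ∪ X) - f (smoothGreedy q k R H ∪ H)) ≤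
      #X * (optValue f k + (k - #R - #H : ℕ) * (2 * t)) := by
  set K := k - #R - #H
  set G := smoothGreedy q k R H
  have hF := hf.smoothAvg H
  have hFm := monotone_smoothAvg hm H
  have hFG : smoothAvg f H G ≤ optValue f k :=
    (smoothAvg_le hm H G).trans (le_optValue f (card_smoothGreedy_union_le q hk))
  have hFR : 0 ≤ smoothAvg f H R := (h0.trans (hm (empty_subset R))).trans (le_smoothAvg hm H R)
  have gain_le : ∀ c ∈ X,
      K * (smoothAvg f H (insert c G) - smoothAvg f H G) ≤ optValue f k + K * (2 * t) := by
    intro c hc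
    have : K * (smoothAvg f H (insert c G) - smoothAvg f H G) ≤
        smoothAvg f H G - smoothAvg f H R + K * (2 * t) :=
      (h.isApproxGreedy hμ ht hm hRH).mul_insert_sub_le hF hFm
        (monotone_iterate_greedyStep q H R) (mem_compl.2 (disjoint_left.1 hX hc))
    linarith
  calc (K : ℝ) * (f (G ∪ H ∪ X) - f (G ∪ H))
      ≤ K * ∑ c ∈ X, (smoothAvg f H (insert c G) - smoothAvg f H G) := by
        gcongr
        exact (hf.union_sub_le_smoothAvg_sub hm H G X).trans (hF.union_sub_le_sum hFm G X)
    _ = ∑ c ∈ X, K * (smoothAvg f H (insert c G) - smoothAvg f H G) := mul_sum ..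
    _ ≤ ∑ _c ∈ X, (optValue f k + K * (2 * t)) := sum_le_sum gain_le
    _ = #X * (optValue f k + K * (2 * t)) := by rw [sum_const, nsmul_eq_mul]

theorem SmoothClose.le_smoothGreedy_union (h : SmoothClose q f μ t k H) (hμ : 0 < μ)
    (ht : 0 ≤ t) (hf : IsSubmodular f) (hm : Monotone f) (h0 : 0 ≤ f ∅) (hk : 0 < k)
    (hRH : Disjoint R H) {δ : ℝ} (hδ : f (R ∪ H) - f R ≤ δ) :
    (optValue f k - δ) * (1 - (1 - 1 / (k : ℝ)) ^ (k - #R - #H)) -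
      (k - #R - #H : ℕ) * (2 * t) ≤ f (smoothGreedy q k R H ∪ H) := by
  obtain ⟨O, hOk, hO⟩ := exists_eq_optValue f k
  set p := (1 - 1 / (k : ℝ)) ^ (k - #R - #H)
  have hk_inv : 1 / (k : ℝ) ≤ 1 := by
    rw [div_le_one (by exact_mod_cast hk)]
    exact_mod_cast hk
  have hp0 : 0 ≤ p := pow_nonneg (sub_nonneg.2 hk_inv) _
  have hp1 : p ≤ 1 := pow_le_one₀ (sub_nonneg.2 hk_inv) (sub_le_self 1 (by positivity))
  have hFR : 0 ≤ smoothAvg f H R := (h0.trans (hm (empty_subset R))).trans (le_smoothAvg hm H R)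
  have opt_sub_le : optValue f k - δ ≤ smoothAvg f H (R ∪ (O \ H)) := by
    have hO_le : f O ≤ f (R ∪ (O \ H) ∪ H) := hm fun x hx => by
      by_cases hxH : x ∈ H <;> simp [hxH, hx]
    linarith [hf.union_sub_le hm (subset_union_left : R ⊆ R ∪ (O \ H)) H,
      le_smoothAvg hm H (R ∪ (O \ H))]
  have greedy : smoothAvg f H (R ∪ (O \ H)) - smoothAvg f H (smoothGreedy q k R H) ≤
      p * (smoothAvg f H (R ∪ (O \ H)) - smoothAvg f H R) + (k - #R - #H : ℕ) * (2 * t) :=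
    (h.isApproxGreedy hμ ht hm hRH).sub_le_pow_mul (hf.smoothAvg H) (monotone_smoothAvg hm H)
      (monotone_iterate_greedyStep q H R) (by positivity)
      (fun x hx => mem_compl.2 (mem_sdiff.1 hx).2) hk ((card_le_card sdiff_subset).trans hOk)
  have := mul_le_mul_of_nonneg_right opt_sub_le (sub_nonneg.2 hp1)
  linarith [smoothAvg_le hm H (smoothGreedy q k R H), mul_nonneg hp0 hFR]

end SmoothGreedy

section Candidates

variable {N : Type*} [Fintype N] [LinearOrder N] {q f : Finset N → ℝ} {μ t : ℝ} {k m l : ℕ}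
  {H : Fin m → Finset N}

theorem biUnion_subset_candidate (q : Finset N → ℝ) (k : ℕ) (H : Fin m → Finset N) (j : Fin m) :
    univ.biUnion H ⊆ candidate q k H j := by
  rw [← biUnion_erase_union_of_mem (mem_univ j)]
  exact union_subset_union_left (monotone_iterate_greedyStep q (H j) _ (Nat.zero_le _))

theorem IsSmoothingFamily.card_candidate_le (hH : IsSmoothingFamily H l) (q : Finset N → ℝ)
    (hk : m * l ≤ k) (j : Fin m) : #(candidate q k H j) ≤ k :=
  card_smoothGreedy_union_le q ((hH.card_biUnion_erase_add j).trans_le hk)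

theorem IsSmoothingFamily.candidate_eq_univ (hH : IsSmoothingFamily H l) (q : Finset N → ℝ)
    (hk : m * l ≤ k) (hN : Fintype.card N ≤ k) (j : Fin m) : candidate q k H j = univ :=
  smoothGreedy_union_eq_univ q (hH.disjoint_biUnion_erase j)
    ((hH.card_biUnion_erase_add j).trans_le hk) hN

/-- All candidates contain the `m * l` smoothing elements, which leaves room for the
comparison sets. -/
theorem IsSmoothingFamily.hasComparisonRoom (hH : IsSmoothingFamily H l) (q : Finset N → ℝ)
    (hk : m * l ≤ k) (hm : 0 < m) (hN : 2 * k ≤ Fintype.card N) : HasComparisonRoom q k l H := by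
  intro i j _
  have hi := hH.card_candidate_le q hk i
  have hj := hH.card_candidate_le q hk j
  have hunion := card_union_add_card_inter (candidate q k H i) (candidate q k H j)
  have hinter := card_le_card (subset_inter (biUnion_subset_candidate q k H i)
    (biUnion_subset_candidate q k H j))
  rw [hH.card_biUnion] at hinter
  have hl : l ≤ m * l := Nat.le_mul_of_pos_left l hm
  rw [card_compl]
  omega

theorem IsSmoothingFamily.mul_candidate_union_sub_le (hH : IsSmoothingFamily H l) {j : Fin m}
    (hclose : SmoothClose q f μ t k (H j)) (hμ : 0 < μ) (ht : 0 ≤ t) (hf : IsSubmodular f)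
    (hm : Monotone f) (h0 : 0 ≤ f ∅) (hk : m * l ≤ k) {X : Finset N} (hX : Disjoint X (H j)) :
    (k - m * l : ℕ) * (f (candidate q k H j ∪ X) - f (candidate q k H j)) ≤
      #X * (optValue f k + (k - m * l : ℕ) * (2 * t)) := by
  have h := hclose.mul_union_sub_le hμ ht hf hm h0 (hH.disjoint_biUnion_erase j)
    ((hH.card_biUnion_erase_add j).trans_le hk) hX
  rwa [Nat.sub_sub, hH.card_biUnion_erase_add] at h

theorem IsSmoothingFamily.exists_le_candidate (hH : IsSmoothingFamily H l)
    (hclose : ∀ j, SmoothClose q f μ t k (H j)) (hμ : 0 < μ) (ht : 0 ≤ t) (hf : IsSubmodular f)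
    (hm : Monotone f) (h0 : 0 ≤ f ∅) (hk0 : 0 < k) (hk : m * l ≤ k) (hm0 : 0 < m) :
    ∃ j, (1 - 1 / (m : ℝ)) * optValue f k * (1 - (1 - 1 / (k : ℝ)) ^ (k - m * l)) -
      (k - m * l : ℕ) * (2 * t) ≤ f (candidate q k H j) := by
  have hmR : (0 : ℝ) < m := by exact_mod_cast hm0
  obtain ⟨j, -, hj⟩ : ∃ j ∈ univ, f (univ.biUnion H) - f ((univ.erase j).biUnion H) ≤
      optValue f k / m := by
    refine exists_le_of_sum_le ⟨⟨0, hm0⟩, mem_univ _⟩ ?_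
    rw [sum_const, card_univ, Fintype.card_fin, nsmul_eq_mul, mul_div_cancel₀ _ hmR.ne']
    linarith [hf.sum_sub_erase_le hm univ H, le_optValue f (hH.card_biUnion.trans_le hk)]
  refine ⟨j, ?_⟩
  rw [← biUnion_erase_union_of_mem (mem_univ j)] at hj
  have h := (hclose j).le_smoothGreedy_union hμ ht hf hm h0 hk0 (hH.disjoint_biUnion_erase j) hj
  rw [Nat.sub_sub, hH.card_biUnion_erase_add] at h
  calc _ = (optValue f k - optValue f k / m) * (1 - (1 - 1 / (k : ℝ)) ^ (k - m * l)) -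
        (k - m * l : ℕ) * (2 * t) := by ring
    _ ≤ f (candidate q k H j) := h

end Candidates

section Tournament

variable {N : Type*} [LinearOrder N]

theorem smoothCompare_eq_or_eq (q : Finset N → ℝ) (T U C : Finset N) :
    smoothCompare q T U C = T ∨ smoothCompare q T U C = U := by
  unfold smoothCompare
  split_ifs
  exacts [Or.inl rfl, Or.inr rfl]

theorem tournament_mem (q : Finset N → ℝ) (C : Finset N → Finset N → Finset N) (T : Finset N)
    (L : List (Finset N)) : tournament q C T L ∈ T :: L := by
  induction L generalizing T with
  | nil => exact List.mem_singleton_self T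
  | cons U L ih =>
    have h := ih (smoothCompare q T U (C T U))
    rw [tournament]
    rcases smoothCompare_eq_or_eq q T U (C T U) with e | e <;> rw [e] at h ⊢
    · exact List.cons_subset_cons T (List.subset_cons_self U L) h
    · exact List.mem_cons_of_mem T h

theorem le_tournament_add {f q : Finset N → ℝ} {C : Finset N → Finset N → Finset N} {t : ℝ}
    (ht : 0 ≤ t) {s : Set (Finset N)}
    (hs : ∀ T ∈ s, ∀ U ∈ s, max (f T) (f U) ≤ f (smoothCompare q T U (C T U)) + t)
    {T : Finset N} {L : List (Finset N)} (hT : ∀ U ∈ T :: L, U ∈ s) :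
    ∀ U ∈ T :: L, f U ≤ f (tournament q C T L) + L.length * t := by
  induction L generalizing T with
  | nil => simp [tournament]
  | cons U L ih =>
    obtain ⟨hTs, hUs, hLs⟩ : T ∈ s ∧ U ∈ s ∧ ∀ V ∈ L, V ∈ s := by
      simpa only [List.forall_mem_cons] using hT
    set W := smoothCompare q T U (C T U) with hW
    have hWs : W ∈ s := by
      rcases smoothCompare_eq_or_eq q T U (C T U) with e | e <;> rw [hW, e] <;> assumption
    obtain ⟨winner_le, rest_le⟩ := List.forall_mem_cons.1 (ih (List.forall_mem_cons.2 ⟨hWs, hLs⟩))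
    obtain ⟨hTW, hUW⟩ := max_le_iff.1 (hs T hTs U hUs)
    rw [tournament, List.length_cons, Nat.cast_succ, add_one_mul]
    exact List.forall_mem_cons.2 ⟨by linarith, List.forall_mem_cons.2
      ⟨by linarith, fun V hV => by linarith [rest_le V hV]⟩⟩

variable [Fintype N] {m : ℕ}

theorem slickGreedy_succ (q : Finset N → ℝ) (k : ℕ) (H : Fin (m + 1) → Finset N)
    (C : Finset N → Finset N → Finset N) :
    slickGreedy q k H C =
      tournament q C (candidate q k H 0) (List.ofFn fun i : Fin m => candidate q k H i.succ) := by
  rw [slickGreedy, List.ofFn_succ]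

theorem mem_candidate_cons_ofFn {q : Finset N → ℝ} {k : ℕ} {H : Fin (m + 1) → Finset N}
    {U : Finset N} :
    U ∈ candidate q k H 0 :: List.ofFn (fun i : Fin m => candidate q k H i.succ) ↔
      U ∈ Set.range (candidate q k H) := by
  rw [← List.ofFn_succ (f := candidate q k H), List.mem_ofFn']

theorem exists_slickGreedy_eq_candidate (q : Finset N → ℝ) (k : ℕ) (H : Fin m → Finset N)
    (C : Finset N → Finset N → Finset N) (hm : 0 < m) :
    ∃ j, slickGreedy q k H C = candidate q k H j := by
  obtain ⟨m, rfl⟩ := Nat.exists_eq_succ_of_ne_zero hm.ne'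
  obtain ⟨j, hj⟩ := mem_candidate_cons_ofFn.1 (tournament_mem q C (candidate q k H 0) _)
  exact ⟨j, (slickGreedy_succ q k H C).trans hj.symm⟩

theorem candidate_le_slickGreedy_add {f q : Finset N → ℝ} {k : ℕ} {H : Fin m → Finset N}
    {C : Finset N → Finset N → Finset N} {t : ℝ} (ht : 0 ≤ t)
    (hcmp : ∀ i j, max (f (candidate q k H i)) (f (candidate q k H j)) ≤
      f (smoothCompare q (candidate q k H i) (candidate q k H j)
        (C (candidate q k H i) (candidate q k H j))) + t)
    (j : Fin m) : f (candidate q k H j) ≤ f (slickGreedy q k H C) + m * t := by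
  obtain ⟨m, rfl⟩ := Nat.exists_eq_succ_of_ne_zero j.pos.ne'
  have h := le_tournament_add ht (Set.forall_mem_range.2 fun i => Set.forall_mem_range.2 (hcmp i))
    (fun _ => mem_candidate_cons_ofFn.1) _ (mem_candidate_cons_ofFn.2 (Set.mem_range_self j))
  rw [List.length_ofFn] at h
  rw [slickGreedy_succ, Nat.cast_succ]
  linarith

end Tournament

section Comparison

variable {N : Type*} [LinearOrder N] {q f : Finset N → ℝ} {r : ℝ} {k l : ℕ}
  {C : Finset N → Finset N → Finset N} {T U : Finset N}

/-- Smooth-Compare with comparison set `A` detects that `T` is better than `U`, provided that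
`f (T ∪ X)` exceeds `f (U ∪ X)` by the factor `1 / r` for all queried `X ⊆ A`. -/
def DetectsBetter (q f : Finset N → ℝ) (r : ℝ) (T U A : Finset N) : Prop :=
  0 < f T → (∀ X ⊆ A, f (U ∪ X) ≤ r * f (T ∪ X)) → wins q U T A < wins q T U A

/-- The comparisons of sets of at most `k` elements with the oracle `q` are reliable, for
admissible comparison sets (of size `l`, and disjoint from the compared sets). -/
def ComparesWell (q f : Finset N → ℝ) (r : ℝ) (k l : ℕ) (C : Finset N → Finset N → Finset N) :
    Prop :=
  ∀ T U : Finset N, #T ≤ k → #U ≤ k → Disjoint (C T U) (T ∪ U) → #(C T U) = l →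
    DetectsBetter q f r T U (C T U) ∧ DetectsBetter q f r U T (C T U)

theorem DetectsBetter.smoothCompare_eq_left {A : Finset N} (h : DetectsBetter q f r T U A)
    (h0 : 0 < f T) (hr : ∀ X ⊆ A, f (U ∪ X) ≤ r * f (T ∪ X)) : smoothCompare q T U A = T :=
  if_pos (Or.inl (h h0 hr))

theorem DetectsBetter.smoothCompare_eq_right {A : Finset N} (h : DetectsBetter q f r U T A)
    (h0 : 0 < f U) (hr : ∀ X ⊆ A, f (T ∪ X) ≤ r * f (U ∪ X)) : smoothCompare q T U A = U :=
  if_neg fun hT => by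
    have := h h0 hr
    omega

theorem union_le_mul_union_of_gap {W β : ℝ} (hm : Monotone f) (hβ : 0 ≤ β) (hβ1 : β ≤ 1)
    (h0 : 0 ≤ W) (hT : f T ≤ W) {X : Finset N} (hTX : f (T ∪ X) ≤ f T + β * W)
    (hUX : f (U ∪ X) ≤ f U + β * W) (hgap : f U + 2 * β * W < f T) :
    f (U ∪ X) ≤ (1 - β / 2) * f (T ∪ X) := by
  have hβW : β * W ≤ W := mul_le_of_le_one_left h0 hβ1
  have : β / 2 * f (T ∪ X) ≤ β / 2 * (2 * W) := by
    gcongr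
    linarith
  linarith [hm (subset_union_left : T ⊆ T ∪ X)]

theorem ComparesWell.max_le_smoothCompare_add [Fintype N] {β : ℝ}
    (h : ComparesWell q f (1 - β / 2) k l C) (hβ : 0 < β) (hβ1 : β ≤ 1) (hm : Monotone f)
    (h0 : 0 ≤ f ∅) (hW : 0 ≤ optValue f k) (hT : #T ≤ k) (hU : #U ≤ k)
    (hA : T ≠ U → Disjoint (C T U) (T ∪ U) ∧ #(C T U) = l ∧
      ∀ X ⊆ C T U, f (T ∪ X) ≤ f T + β * optValue f k ∧ f (U ∪ X) ≤ f U + β * optValue f k) :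
    max (f T) (f U) ≤ f (smoothCompare q T U (C T U)) + 2 * β * optValue f k := by
  set W := optValue f k
  have hβW : 0 ≤ 2 * β * W := by positivity
  have hnonneg : ∀ S, 0 ≤ f S := fun S => h0.trans (hm (empty_subset S))
  rcases eq_or_ne T U with rfl | hTU
  · rcases smoothCompare_eq_or_eq q T T (C T T) with e | e <;> rw [e, max_self] <;> linarith
  obtain ⟨hdisj, hl, hgain⟩ := hA hTU
  obtain ⟨hleft, hright⟩ := h T U hT hU hdisj hl
  rcases lt_or_ge (f U + 2 * β * W) (f T) with hT_better | hT_le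
  · rw [hleft.smoothCompare_eq_left (by linarith [hnonneg U]) fun X hX =>
      union_le_mul_union_of_gap hm hβ.le hβ1 hW (le_optValue f hT) (hgain X hX).1 (hgain X hX).2
        hT_better]
    exact max_le (by linarith) (by linarith)
  rcases lt_or_ge (f T + 2 * β * W) (f U) with hU_better | hU_le
  · rw [hright.smoothCompare_eq_right (by linarith [hnonneg T]) fun X hX =>
      union_le_mul_union_of_gap hm hβ.le hβ1 hW (le_optValue f hU) (hgain X hX).2 (hgain X hX).1
        hU_better]
    exact max_le (by linarith) (by linarith)
  rcases smoothCompare_eq_or_eq q T U (C T U) with e | e <;> rw [e] <;>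
    exact max_le (by linarith) (by linarith)

end Comparison

section Approximation

theorem numSets_bounds {ε : ℝ} (hε : 0 < ε) (hε1 : ε ≤ 1) :
    6 ≤ ε * numSets ε ∧ ε * numSets ε ≤ 7 := by
  have hlower : 6 / ε ≤ numSets ε := Nat.le_ceil _
  have hupper : (numSets ε : ℝ) < 6 / ε + 1 := Nat.ceil_lt_add_one (by positivity)
  constructor
  · rwa [div_le_iff₀' hε] at hlower
  · calc ε * numSets ε ≤ ε * (6 / ε + 1) := by gcongr
      _ = 6 + ε := by field_simp
      _ ≤ 7 := by linarith

theorem mul_le_of_size_le {ε k l m : ℝ} (hm : 0 ≤ m) (hεm : ε * m ≤ 7) (hk : 0 ≤ k)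
    (hε : 0 ≤ ε) (hl : l ≤ ε ^ 2 / 92 * k) : m * l ≤ 7 / 92 * ε * k :=
  calc m * l ≤ m * (ε ^ 2 / 92 * k) := by gcongr
    _ = (ε * m) * (ε / 92 * k) := by ring
    _ ≤ 7 * (ε / 92 * k) := by gcongr
    _ = 7 / 92 * ε * k := by ring

theorem one_sub_inv_pow_le_exp {k K : ℕ} {x : ℝ} (hk : 0 < k) (hK : (K : ℝ) = k * (1 - x)) :
    (1 - 1 / (k : ℝ)) ^ K ≤ Real.exp (x - 1) := by
  have hkR : (1 : ℝ) ≤ k := by exact_mod_cast hk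
  have hbase : 0 ≤ 1 - 1 / (k : ℝ) := sub_nonneg.2 <| (div_le_one (by linarith)).2 hkR
  calc (1 - 1 / (k : ℝ)) ^ K ≤ Real.exp (-(1 / (k : ℝ))) ^ K :=
        pow_le_pow_left₀ hbase (Real.one_sub_le_exp_neg _) K
    _ = Real.exp (x - 1) := by
        rw [← Real.exp_nat_mul, hK]
        congr 1
        field_simp
        ring

theorem exp_sub_one_le {x : ℝ} (hx0 : 0 ≤ x) (hx1 : x ≤ 1 / 4) :
    Real.exp (x - 1) ≤ 1 / Real.exp 1 + 5 / 8 * x := by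
  have htaylor : Real.exp x ≤ 1 + x + x ^ 2 := by
    have := Real.abs_exp_sub_one_sub_id_le (x := x) (by rw [abs_of_nonneg hx0]; linarith)
    linarith [(abs_le.1 this).2]
  have hsq : x ^ 2 ≤ x / 4 := by nlinarith
  have he : 1 / Real.exp 1 ≤ 1 / 2 :=
    one_div_le_one_div_of_le (by norm_num) (by linarith [Real.exp_one_gt_d9])
  calc Real.exp (x - 1) = Real.exp x * (1 / Real.exp 1) := by rw [Real.exp_sub, mul_one_div]
    _ ≤ (1 + 5 / 4 * x) * (1 / Real.exp 1) := by
        gcongr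
        linarith
    _ = 1 / Real.exp 1 + 5 / 4 * x * (1 / Real.exp 1) := by ring
    _ ≤ 1 / Real.exp 1 + 5 / 4 * x * (1 / 2) := by gcongr
    _ = 1 / Real.exp 1 + 5 / 8 * x := by ring

theorem approximation_ratio_le {ε x m : ℝ} {k K : ℕ} (hε : 0 < ε) (hε1 : ε ≤ 1)
    (hm : 6 ≤ ε * m) (hk : 0 < k) (hx0 : 0 ≤ x) (hx : x ≤ 7 / 92 * ε)
    (hK : (K : ℝ) = k * (1 - x)) :
    1 - 1 / Real.exp 1 - 0.3 * ε ≤ (1 - 1 / m) * (1 - (1 - 1 / (k : ℝ)) ^ K) := by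
  have hm0 : 0 < m := pos_of_mul_pos_right (by linarith) hε.le
  have hm_inv : 1 / m ≤ ε / 6 := by
    rw [div_le_div_iff₀ hm0 (by norm_num)]
    linarith
  set p := (1 - 1 / (k : ℝ)) ^ K
  have hp : p ≤ 1 / Real.exp 1 + 5 / 8 * x :=
    (one_sub_inv_pow_le_exp hk hK).trans (exp_sub_one_le hx0 (by linarith))
  have hp0 : 0 ≤ p := pow_nonneg (sub_nonneg.2 <|
    (div_le_one (by exact_mod_cast hk)).2 (by exact_mod_cast hk)) K
  have hmp : 0 ≤ 1 / m * p := by positivity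
  linarith

variable {N : Type*} [Fintype N] [LinearOrder N] {q f : Finset N → ℝ} {ε μ : ℝ} {k m l : ℕ}
  {H : Fin m → Finset N}

theorem IsSmoothingFamily.candidate_union_le (hH : IsSmoothingFamily H l) {j : Fin m}
    (hε : 0 < ε) (hε1 : ε ≤ 1) (hεm : ε * m ≤ 7) (hk : 0 < k) (hl : (l : ℝ) ≤ ε ^ 2 / 92 * k)
    (hmlk : m * l ≤ k) (hW : 0 ≤ optValue f k)
    (hclose : SmoothClose q f μ (ε / (100 * k) * optValue f k) k (H j)) (hμ : 0 < μ)
    (hf : IsSubmodular f) (hm : Monotone f) (h0 : 0 ≤ f ∅) {X : Finset N}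
    (hX : Disjoint X (H j)) (hXl : #X ≤ l) :
    f (candidate q k H j ∪ X) ≤ f (candidate q k H j) + ε ^ 2 / 80 * optValue f k := by
  have hgain := hH.mul_candidate_union_sub_le hclose hμ (by positivity) hf hm h0 hmlk hX
  set W := optValue f k
  set K := k - m * l with hK
  have hkR : (0 : ℝ) < k := by exact_mod_cast hk
  have hml := mul_le_of_size_le m.cast_nonneg hεm hkR.le hε.le hl
  have hεk : ε * k ≤ k := mul_le_of_le_one_left hkR.le hε1
  have hKR : (K : ℝ) = k - m * l := by rw [hK, Nat.cast_sub hmlk, Nat.cast_mul]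
  have hK_ge : 85 / 92 * (k : ℝ) ≤ K := by linarith
  have noise_le : K * (2 * (ε / (100 * k) * W)) ≤ W / 50 :=
    calc K * (2 * (ε / (100 * k) * W)) ≤ k * (2 * (1 / (100 * k) * W)) := by
          gcongr
          exact Nat.sub_le k _
      _ = W / 50 := by field_simp; ring
  have hXk : (#X : ℝ) ≤ ε ^ 2 / 92 * k := le_trans (by exact_mod_cast hXl) hl
  refine sub_le_iff_le_add'.1 (le_of_mul_le_mul_left ?_ (by linarith : (0 : ℝ) < K))
  calc K * (f (candidate q k H j ∪ X) - f (candidate q k H j))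
      ≤ #X * (W + K * (2 * (ε / (100 * k) * W))) := hgain
    _ ≤ (ε ^ 2 / 92 * k) * (W + W / 50) := by gcongr
    _ ≤ (85 / 92 * k) * (ε ^ 2 / 80 * W) := by
        have : 0 ≤ ε ^ 2 * k * W := by positivity
        linarith
    _ ≤ K * (ε ^ 2 / 80 * W) := by gcongr

theorem IsSmoothingFamily.exists_approx_candidate (hH : IsSmoothingFamily H l)
    (hε : 0 < ε) (hε1 : ε ≤ 1) (hεm : 6 ≤ ε * m ∧ ε * m ≤ 7) (hk : 0 < k)
    (hl : (l : ℝ) ≤ ε ^ 2 / 92 * k) (hmlk : m * l ≤ k) (hW : 0 ≤ optValue f k)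
    (hclose : ∀ j, SmoothClose q f μ (ε / (100 * k) * optValue f k) k (H j)) (hμ : 0 < μ)
    (hf : IsSubmodular f) (hm : Monotone f) (h0 : 0 ≤ f ∅) :
    ∃ j, (1 - 1 / Real.exp 1 - 0.32 * ε) * optValue f k ≤ f (candidate q k H j) := by
  have hm0 : 0 < m := by
    have : (0 : ℝ) < m := pos_of_mul_pos_right (by linarith [hεm.1]) hε.le
    exact_mod_cast this
  obtain ⟨j, hj⟩ := hH.exists_le_candidate hclose hμ (by positivity) hf hm h0 hk hmlk hm0
  refine ⟨j, le_trans ?_ hj⟩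
  set W := optValue f k
  set K := k - m * l with hK
  have hkR : (0 : ℝ) < k := by exact_mod_cast hk
  have hKR : (K : ℝ) = k - m * l := by rw [hK, Nat.cast_sub hmlk, Nat.cast_mul]
  have ratio := approximation_ratio_le (x := m * l / k) (K := K) hε hε1 hεm.1 hk (by positivity)
    ((div_le_iff₀ hkR).2 (mul_le_of_size_le m.cast_nonneg hεm.2 hkR.le hε.le hl))
    (by rw [hKR]; field_simp)
  have noise_le : K * (2 * (ε / (100 * k) * W)) ≤ 0.02 * ε * W :=
    calc K * (2 * (ε / (100 * k) * W)) ≤ k * (2 * (ε / (100 * k) * W)) := by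
          gcongr
          exact Nat.sub_le k _
      _ = 0.02 * ε * W := by field_simp; norm_num; ring
  linarith [mul_le_mul_of_nonneg_right ratio hW]

/-- The sets `C T U`, of `l` elements disjoint from `T ∪ U`, are a rule by which Slick-Greedy may
choose its comparison sets; nothing is required where there is no room for such a set. -/
def IsComparisonRule (C : Finset N → Finset N → Finset N) (l : ℕ) : Prop :=
  ∀ T U : Finset N, l ≤ #(T ∪ U)ᶜ → Disjoint (C T U) (T ∪ U) ∧ #(C T U) = l

theorem IsSmoothingFamily.slickGreedy_approx (hH : IsSmoothingFamily H l)
    {C : Finset N → Finset N → Finset N} (hC : IsComparisonRule C l) (hε : 0 < ε) (hε1 : ε ≤ 1)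
    (hεm : 6 ≤ ε * m ∧ ε * m ≤ 7) (hk : 0 < k) (hl : (l : ℝ) ≤ ε ^ 2 / 92 * k)
    (hmlk : m * l ≤ k) (hW : 0 ≤ optValue f k)
    (hclose : ∀ j, SmoothClose q f μ (ε / (100 * k) * optValue f k) k (H j)) (hμ : 0 < μ)
    (hcmp : ComparesWell q f (1 - ε ^ 2 / 80 / 2) k l C) (hroom : HasComparisonRoom q k l H)
    (hf : IsSubmodular f) (hm : Monotone f) (h0 : 0 ≤ f ∅) :
    (1 - 1 / Real.exp 1 - ε) * optValue f k ≤ f (slickGreedy q k H C) := by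
  obtain ⟨j, hj⟩ := hH.exists_approx_candidate hε hε1 hεm hk hl hmlk hW hclose hμ hf hm h0
  have hcompare : ∀ i i', max (f (candidate q k H i)) (f (candidate q k H i')) ≤
      f (smoothCompare q (candidate q k H i) (candidate q k H i')
        (C (candidate q k H i) (candidate q k H i'))) + 2 * (ε ^ 2 / 80) * optValue f k := by
    intro i i'
    refine hcmp.max_le_smoothCompare_add (by positivity) (by nlinarith) hm h0 hW
      (hH.card_candidate_le q hmlk i) (hH.card_candidate_le q hmlk i') fun hne => ?_
    obtain ⟨hdisj, hcard⟩ := hC _ _ (hroom i i' hne)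
    have gain : ∀ j, candidate q k H j ⊆ candidate q k H i ∪ candidate q k H i' →
        ∀ X ⊆ C (candidate q k H i) (candidate q k H i'),
          f (candidate q k H j ∪ X) ≤ f (candidate q k H j) + ε ^ 2 / 80 * optValue f k :=
      fun j hj X hX => hH.candidate_union_le hε hε1 hεm.2 hk hl hmlk hW (hclose j) hμ hf hm h0
        (hdisj.mono hX (subset_union_right.trans hj)) (hcard ▸ card_le_card hX)
    exact ⟨hdisj, hcard, fun X hX =>
      ⟨gain i subset_union_left X hX, gain i' subset_union_right X hX⟩⟩
  have hwinner := candidate_le_slickGreedy_add (by positivity) hcompare j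
  have loss_le : m * (2 * (ε ^ 2 / 80) * optValue f k) ≤ 7 / 40 * ε * optValue f k :=
    calc m * (2 * (ε ^ 2 / 80) * optValue f k) = (ε * m) * (ε * optValue f k / 40) := by ring
      _ ≤ 7 * (ε * optValue f k / 40) := by gcongr; exact hεm.2
      _ = 7 / 40 * ε * optValue f k := by ring
  linarith [mul_nonneg hε.le hW]

end Approximation

section Moments

open Filter Topology

theorem neg_tsum_mul_rpow_le_sub_of_hasSum_rpow {a α : ℕ → ℝ} {x y G : ℝ} (hα : Antitone α)
    (hy : 0 < y) (hyx : y ≤ x) (hay : Summable fun i => a (i + 1) * y ^ α (i + 1))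
    (hG : HasSum (fun i => a i * x ^ α i) G) :
    -((∑' i, |a (i + 1) * y ^ α (i + 1)|) * (x / y) ^ α 1) ≤ G - a 0 * x ^ α 0 := by
  have hx : 0 < x := hy.trans_le hyx
  have hterm : ∀ i, -(|a (i + 1) * y ^ α (i + 1)| * (x / y) ^ α 1) ≤
      a (i + 1) * x ^ α (i + 1) := fun i => by
    have hrpow : (x / y) ^ α (i + 1) ≤ (x / y) ^ α 1 :=
      Real.rpow_le_rpow_of_exponent_le ((one_le_div hy).2 hyx) (hα (by omega))
    have hscale : x ^ α (i + 1) = y ^ α (i + 1) * (x / y) ^ α (i + 1) := by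
      rw [← Real.mul_rpow hy.le (by positivity), mul_div_cancel₀ _ hy.ne']
    rw [neg_le, hscale]
    calc -(a (i + 1) * (y ^ α (i + 1) * (x / y) ^ α (i + 1)))
        = -(a (i + 1) * y ^ α (i + 1)) * (x / y) ^ α (i + 1) := by ring
      _ ≤ |a (i + 1) * y ^ α (i + 1)| * (x / y) ^ α 1 := by
        gcongr
        exact neg_le_abs _
  have htail : HasSum (fun i => a (i + 1) * x ^ α (i + 1)) (G - a 0 * x ^ α 0) := by
    simpa using (hasSum_nat_add_iff' 1).2 hG
  exact hasSum_le hterm (hay.abs.hasSum.mul_right _).neg htail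

theorem exists_linear_le_of_hasSum_rpow {x₀ : ℝ} {a α : ℕ → ℝ} {g : ℝ → ℝ} (hx₀ : 0 < x₀)
    (hα : Antitone α) (h1 : 1 ≤ α 0) (h01 : α 1 < α 0) (ha : 0 < a 0)
    (hg : ∀ x, x₀ < x → HasSum (fun i => a i * x ^ α i) (g x)) :
    ∃ c > 0, ∃ M, x₀ ≤ M ∧ ∀ x, M < x → c * x ≤ g x := by
  set y := x₀ + 1
  have hxy : x₀ < y := lt_add_one x₀
  have hy : 0 < y := hx₀.trans hxy
  have hay : Summable fun i => a (i + 1) * y ^ α (i + 1) :=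
    (summable_nat_add_iff 1).2 (hg y hxy).summable
  set B := ∑' i, |a (i + 1) * y ^ α (i + 1)|
  have hlim : Tendsto (fun x : ℝ => B / y ^ α 1 * x ^ (-(α 0 - α 1))) atTop (𝓝 0) := by
    simpa using (tendsto_rpow_neg_atTop (sub_pos.2 h01)).const_mul (B / y ^ α 1)
  obtain ⟨M, hM⟩ := eventually_atTop.1 (hlim.eventually (gt_mem_nhds (half_pos ha)))
  refine ⟨a 0 / 2, half_pos ha, max M y, le_max_of_le_right hxy.le, fun x hx => ?_⟩
  obtain ⟨hMx, hyx⟩ := max_lt_iff.1 hx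
  have hx0 : 0 < x := hy.trans hyx
  have hlead : x ≤ x ^ α 0 := by
    simpa using Real.rpow_le_rpow_of_exponent_le (by linarith : (1 : ℝ) ≤ x) h1
  have htail := neg_tsum_mul_rpow_le_sub_of_hasSum_rpow hα hy hyx.le hay (hg x (hxy.trans hyx))
  calc a 0 / 2 * x ≤ a 0 / 2 * x ^ α 0 := by gcongr
    _ = a 0 * x ^ α 0 - a 0 / 2 * x ^ α 0 := by ring
    _ ≤ a 0 * x ^ α 0 - B / y ^ α 1 * x ^ (-(α 0 - α 1)) * x ^ α 0 := by
      gcongr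
      exact (hM x hMx.le).le
    _ = a 0 * x ^ α 0 - B * (x / y) ^ α 1 := by
      rw [mul_assoc, ← Real.rpow_add hx0, Real.div_rpow hx0.le hy.le]
      ring_nf
    _ ≤ g x := by linarith

theorem integrableOn_exp_of_restrict_le {D : Measure ℝ} {c M : ℝ} (hc : 0 < c)
    (hD : D.restrict (Set.Ioi M) ≤ (volume.restrict (Set.Ioi M)).withDensity
      fun x => ENNReal.ofReal (Real.exp (-(c * x)))) :
    IntegrableOn (fun x => Real.exp (c / 2 * x)) (Set.Ioi M) D := by
  refine Integrable.mono_measure ?_ hD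
  rw [integrable_withDensity_iff_integrable_smul' (by fun_prop)
    (ae_of_all _ fun _ => ENNReal.ofReal_lt_top)]
  refine (exp_neg_integrableOn_Ioi M (half_pos hc)).congr (ae_of_all _ fun x => ?_)
  beta_reduce
  rw [ENNReal.toReal_ofReal (Real.exp_pos _).le, smul_eq_mul, ← Real.exp_add]
  ring_nf

theorem HasExponentialUpperTail.exists_integrableOn_exp {D : Measure ℝ}
    (hD : HasExponentialUpperTail D) :
    ∃ s > 0, ∃ M : ℝ, IntegrableOn (fun x => Real.exp (s * x)) (Set.Ioi M) D := by
  obtain ⟨x₀, a, α, g, hx₀, hα, h1, h01, ha, hg, hD⟩ := hD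
  obtain ⟨c, hc, M, hM, hlin⟩ := exists_linear_le_of_hasSum_rpow hx₀ hα h1 h01 ha hg
  have hrestrict : D.restrict (Set.Ioi M) = (volume.restrict (Set.Ioi M)).withDensity
      fun x => ENNReal.ofReal (Real.exp (-g x)) := by
    have := congrArg (fun ν : Measure ℝ => ν.restrict (Set.Ioi M)) hD
    rwa [restrict_withDensity measurableSet_Ioi, Measure.restrict_restrict measurableSet_Ioi,
      Measure.restrict_restrict measurableSet_Ioi, Set.inter_eq_left.2 (Set.Ioi_subset_Ioi hM)]
      at this
  refine ⟨c / 2, half_pos hc, M, integrableOn_exp_of_restrict_le hc ?_⟩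
  rw [hrestrict]
  refine withDensity_mono ?_
  filter_upwards [ae_restrict_mem measurableSet_Ioi] with x hx
  gcongr
  exact hlin x hx

theorem zero_mem_interior_integrableExpSet {Ω : Type*} {_ : MeasurableSpace Ω} {P : Measure Ω}
    {X : Ω → ℝ} {s : ℝ} (hs : 0 < s) (hpos : Integrable (fun ω => Real.exp (s * X ω)) P)
    (hneg : Integrable (fun ω => Real.exp (-s * X ω)) P) :
    0 ∈ interior (integrableExpSet X P) :=
  mem_interior.2 ⟨Set.Ioo (-s) s,
    fun _ ht => integrable_exp_mul_of_le_of_le hneg hpos ht.1.le ht.2.le, isOpen_Ioo,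
    neg_neg_of_pos hs, hs⟩

theorem HasExponentialUpperTail.zero_mem_interior_integrableExpSet {D : Measure ℝ}
    [IsFiniteMeasure D] (hD : HasExponentialUpperTail D) (hnonneg : ∀ᵐ x ∂D, 0 ≤ x) :
    0 ∈ interior (integrableExpSet id D) := by
  obtain ⟨s, hs, M, hupper⟩ := hD.exists_integrableOn_exp
  have hlower : IntegrableOn (fun x => Real.exp (s * x)) (Set.Iic M) D := by
    refine Integrable.of_mem_Icc 0 (Real.exp (s * M)) (by fun_prop) ?_
    filter_upwards [ae_restrict_mem measurableSet_Iic] with x hx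
    exact ⟨(Real.exp_pos _).le, Real.exp_le_exp.2 (mul_le_mul_of_nonneg_left hx hs.le)⟩
  have hpos : Integrable (fun x => Real.exp (s * x)) D := by
    simpa using hlower.union hupper
  have hneg : Integrable (fun x => Real.exp (-s * x)) D := by
    refine Integrable.of_mem_Icc 0 1 (by fun_prop) ?_
    filter_upwards [hnonneg] with x hx
    exact ⟨(Real.exp_pos _).le, Real.exp_le_one_iff.2 (by nlinarith)⟩
  exact NoisySubmodular.zero_mem_interior_integrableExpSet hs hpos hneg

theorem HasBoundedTail.zero_mem_interior_integrableExpSet {D : Measure ℝ} [IsFiniteMeasure D]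
    (hD : HasBoundedTail D) : 0 ∈ interior (integrableExpSet id D) := by
  obtain ⟨a, b, hab, -⟩ := hD
  have hexp : ∀ t : ℝ, Integrable (fun x => Real.exp (t * id x)) D := fun t =>
    integrable_exp_mul_of_mem_Icc aemeasurable_id hab
  exact NoisySubmodular.zero_mem_interior_integrableExpSet one_pos (hexp 1) (hexp (-1))

theorem IsMultiplierLaw.zero_mem_interior_integrableExpSet {D : Measure ℝ} [IsFiniteMeasure D]
    (hD' : IsMultiplierLaw D) (hD : HasGeneralizedExponentialTail D) :
    0 ∈ interior (integrableExpSet id D) := by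
  rcases hD' with ⟨hnonneg, -⟩ | ⟨m, v, -, rfl⟩
  · rcases hD with htail | htail
    · exact htail.zero_mem_interior_integrableExpSet hnonneg
    · exact htail.zero_mem_interior_integrableExpSet
  · simp [integrableExpSet_id_gaussianReal]

theorem IsMultiplierLaw.integral_pos {D : Measure ℝ} (hD : IsMultiplierLaw D)
    (hint : Integrable id D) : 0 < ∫ x, x ∂D := by
  rcases hD with ⟨hnonneg, hne⟩ | ⟨m, v, hm, rfl⟩
  · refine (integral_nonneg_of_ae hnonneg).lt_of_ne fun h => hne ?_
    exact (integral_eq_zero_iff_of_nonneg_ae hnonneg hint).1 h.symm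
  · rwa [integral_id_gaussianReal]

/-- A law on `ℝ` is sub-exponential with parameters `K` and `r` if its moment generating function
is finite on `[-r, r]` and there dominated by that of a Gaussian with the same mean and variance
`2 * K`. -/
def IsSubexponential (D : Measure ℝ) (K r : ℝ) : Prop :=
  ∀ t, |t| ≤ r → Integrable (fun x => Real.exp (t * x)) D ∧
    mgf id D t ≤ Real.exp (t * ∫ x, x ∂D + K * t ^ 2)

theorem IsSubexponential.mono {D : Measure ℝ} {K K' r : ℝ} (hD : IsSubexponential D K r)
    (hK : K ≤ K') : IsSubexponential D K' r := fun t ht =>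
  ⟨(hD t ht).1, (hD t ht).2.trans (by gcongr)⟩

theorem isBigO_cgf_sub_linear {Ω : Type*} {_ : MeasurableSpace Ω} {P : Measure Ω}
    [IsProbabilityMeasure P] {X : Ω → ℝ} (hX : 0 ∈ interior (integrableExpSet X P)) :
    (fun t => cgf X P t - t * P[X]) =O[𝓝 0] fun t => t ^ 2 := by
  have htaylor := (analyticAt_cgf hX).hasFPowerSeriesAt.isBigO_sub_partialSum_pow 2
  simpa [FormalMultilinearSeries.partialSum, sum_range_succ, deriv_cgf_zero hX] using htaylor

theorem exists_isSubexponential {D : Measure ℝ} [IsProbabilityMeasure D]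
    (hD : 0 ∈ interior (integrableExpSet id D)) :
    ∃ K > 0, ∃ r > 0, IsSubexponential D K r := by
  obtain ⟨K, hK, hbound⟩ := (isBigO_cgf_sub_linear hD).exists_pos
  obtain ⟨δ, hδ, hball⟩ := Metric.eventually_nhds_iff.1
    (hbound.bound.and (mem_interior_iff_mem_nhds.1 hD))
  refine ⟨K, hK, δ / 2, half_pos hδ, fun t ht => ?_⟩
  obtain ⟨hcgf, hint⟩ := hball (y := t) (by rw [dist_zero_right, Real.norm_eq_abs]; linarith)
  refine ⟨hint, ?_⟩
  rw [← exp_cgf hint]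
  have hle := (le_abs_self _).trans hcgf
  rw [Real.norm_of_nonneg (sq_nonneg t)] at hle
  exact Real.exp_le_exp.2 (by simpa using sub_le_iff_le_add'.1 hle)

end Moments

section Concentration

variable {κ : Type*} [Fintype κ] {D : Measure ℝ} [IsProbabilityMeasure D] {K r W τ : ℝ}
  {I : Finset κ} {w : κ → ℝ}

theorem IsSubexponential.mgf_mul_centered_le (hD : IsSubexponential D K r) {c t : ℝ}
    (h : |t * c| ≤ r) (i : κ) :
    Integrable (fun ξ : κ → ℝ => Real.exp (t * (c * (ξ i - ∫ x, x ∂D))))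
      (Measure.pi fun _ => D) ∧
    mgf (fun ξ : κ → ℝ => c * (ξ i - ∫ x, x ∂D)) (Measure.pi fun _ => D) t ≤
      Real.exp (K * (t * c) ^ 2) := by
  obtain ⟨hint, hmgf⟩ := hD (t * c) h
  set μ := ∫ x, x ∂D
  have hsplit : ∀ x, Real.exp (t * (c * (x - μ))) =
      Real.exp (-(t * c * μ)) * Real.exp (t * c * x) := fun x => by
    rw [← Real.exp_add]; ring_nf
  have hintc : Integrable (fun x => Real.exp (t * (c * (x - μ)))) D := by
    simp only [hsplit]
    exact hint.const_mul _
  refine ⟨(measurePreserving_eval (fun _ : κ => D) i).integrable_comp_of_integrable hintc, ?_⟩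
  calc mgf (fun ξ : κ → ℝ => c * (ξ i - μ)) (Measure.pi fun _ => D) t
      = ∫ x, Real.exp (t * (c * (x - μ))) ∂D :=
        integral_comp_eval (μ := fun _ : κ => D) (i := i) hintc.aestronglyMeasurable
    _ = Real.exp (-(t * c * μ)) * mgf id D (t * c) := by
        simp only [hsplit, integral_const_mul, mgf, id]
    _ ≤ Real.exp (-(t * c * μ)) * Real.exp (t * c * μ + K * (t * c) ^ 2) := by gcongr
    _ = Real.exp (K * (t * c) ^ 2) := by rw [← Real.exp_add]; ring_nf

theorem IsSubexponential.measureReal_sum_ge_le (hD : IsSubexponential D K r) (hK : 0 < K)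
    (hW : 0 < W) (hτ : 0 ≤ τ) (hτr : τ ≤ 2 * K * r) (hw : ∀ i ∈ I, |w i| ≤ W) :
    (Measure.pi fun _ : κ => D).real {ξ | τ * W * #I ≤ ∑ i ∈ I, w i * (ξ i - ∫ x, x ∂D)} ≤
      Real.exp (-(τ ^ 2 * #I / (4 * K))) := by
  set P := Measure.pi fun _ : κ => D
  set X : κ → (κ → ℝ) → ℝ := fun i ξ => w i * (ξ i - ∫ x, x ∂D)
  have hX : ∀ i, Measurable (X i) := fun i => by fun_prop
  have hindep : iIndepFun X P :=
    iIndepFun_pi (μ := fun _ : κ => D) (X := fun i x => w i * (x - ∫ x, x ∂D))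
      fun i => by fun_prop
  -- `t` minimizes the exponent `-t * (τ * W * #I) + #I * K * (t * W) ^ 2`
  set t := τ / (2 * K * W) with ht
  have ht0 : 0 ≤ t := by positivity
  have htW : t * W ≤ r := by
    have : t * W = τ / (2 * K) := by rw [ht]; field_simp
    rw [this, div_le_iff₀ (by positivity)]
    linarith
  have htw : ∀ i ∈ I, |t * w i| ≤ t * W := fun i hi => by
    rw [abs_mul, abs_of_nonneg ht0]
    exact mul_le_mul_of_nonneg_left (hw i hi) ht0
  have hint : ∀ i ∈ I, Integrable (fun ξ => Real.exp (t * X i ξ)) P := fun i hi =>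
    (hD.mgf_mul_centered_le ((htw i hi).trans htW) i).1
  have hmgf : mgf (∑ i ∈ I, X i) P t ≤ Real.exp (#I * (K * (t * W) ^ 2)) := by
    rw [hindep.mgf_sum hX, Real.exp_nat_mul, ← prod_const]
    refine prod_le_prod (fun i _ => mgf_nonneg) fun i hi => ?_
    refine (hD.mgf_mul_centered_le ((htw i hi).trans htW) i).2.trans ?_
    exact Real.exp_le_exp.2 (mul_le_mul_of_nonneg_left
      (sq_le_sq' (abs_le.1 (htw i hi)).1 (abs_le.1 (htw i hi)).2) hK.le)
  calc P.real {ξ | τ * W * #I ≤ ∑ i ∈ I, X i ξ}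
      = P.real {ξ | τ * W * #I ≤ (∑ i ∈ I, X i) ξ} := by simp only [Finset.sum_apply]
    _ ≤ Real.exp (-t * (τ * W * #I)) * mgf (∑ i ∈ I, X i) P t :=
        measure_ge_le_exp_mul_mgf _ ht0 (hindep.integrable_exp_mul_sum hX hint)
    _ ≤ Real.exp (-t * (τ * W * #I)) * Real.exp (#I * (K * (t * W) ^ 2)) := by gcongr
    _ = Real.exp (-(τ ^ 2 * #I / (4 * K))) := by
        rw [← Real.exp_add, ht]
        congr 1
        field_simp
        ring

theorem IsSubexponential.measureReal_abs_sum_gt_le (hD : IsSubexponential D K r) (hK : 0 < K)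
    (hW : 0 < W) (hτ : 0 ≤ τ) (hτr : τ ≤ 2 * K * r) (hw : ∀ i ∈ I, |w i| ≤ W) :
    (Measure.pi fun _ : κ => D).real
        {ξ | τ * W * #I < |∑ i ∈ I, w i * (ξ i - ∫ x, x ∂D)|} ≤
      2 * Real.exp (-(τ ^ 2 * #I / (4 * K))) := by
  set μ := ∫ x, x ∂D
  have hupper := hD.measureReal_sum_ge_le hK hW hτ hτr hw
  have hlower := hD.measureReal_sum_ge_le (w := fun i => -w i) hK hW hτ hτr
    fun i hi => by simpa using hw i hi
  simp only [neg_mul, sum_neg_distrib] at hlower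
  have hsub : {ξ : κ → ℝ | τ * W * #I < |∑ i ∈ I, w i * (ξ i - μ)|} ⊆
      {ξ | τ * W * #I ≤ ∑ i ∈ I, w i * (ξ i - μ)} ∪
        {ξ | τ * W * #I ≤ -∑ i ∈ I, w i * (ξ i - μ)} := by
    intro ξ hξ
    rw [Set.mem_ofPred_eq, lt_abs] at hξ
    rw [Set.mem_union, Set.mem_ofPred_eq, Set.mem_ofPred_eq]
    exact hξ.imp le_of_lt le_of_lt
  linarith [measureReal_mono hsub (measure_ne_top (Measure.pi fun _ : κ => D) _),
    measureReal_union_le (μ := Measure.pi fun _ : κ => D)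
      {ξ | τ * W * #I ≤ ∑ i ∈ I, w i * (ξ i - μ)}
      {ξ | τ * W * #I ≤ -∑ i ∈ I, w i * (ξ i - μ)}]

end Concentration

section FavorsLarger

theorem sign_add_sign_nonneg {a b : ℝ} (h : 0 ≤ a + b) : 0 ≤ Real.sign a + Real.sign b := by
  rcases lt_trichotomy a 0 with ha | rfl | ha
  · rw [Real.sign_of_neg ha, Real.sign_of_pos (by linarith)]
    norm_num
  · rw [zero_add] at h
    rcases h.eq_or_lt with rfl | hb
    · simp
    · simp [Real.sign_of_pos hb]
  · rw [Real.sign_of_pos ha]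
    rcases Real.sign_apply_eq b with hb | hb | hb <;> rw [hb] <;> norm_num

theorem sign_mem_Icc (x : ℝ) : Real.sign x ∈ Set.Icc (-1) 1 := by
  rcases Real.sign_apply_eq x with h | h | h <;> rw [h] <;> norm_num

theorem measurable_sign : Measurable Real.sign :=
  Measurable.ite measurableSet_Iio measurable_const
    (Measurable.ite measurableSet_Ioi measurable_const measurable_const)

theorem integrable_sign_comp {Ω : Type*} {_ : MeasurableSpace Ω} {P : Measure Ω}
    [IsFiniteMeasure P] {φ : Ω → ℝ} (hφ : Measurable φ) :
    Integrable (fun ω => Real.sign (φ ω)) P :=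
  Integrable.of_mem_Icc (-1) 1 (measurable_sign.comp hφ).aemeasurable
    (ae_of_all _ fun _ => sign_mem_Icc _)

theorem measureReal_le_integral_sign {Ω : Type*} {_ : MeasurableSpace Ω} {P : Measure Ω}
    [IsFiniteMeasure P] {φ : Ω → ℝ} {σ : Ω → Ω} {A : Set Ω} (hσ : MeasurePreserving σ P P)
    (hφ : Measurable φ) (hA : MeasurableSet A) (hsum : ∀ᵐ ω ∂P, 0 ≤ φ ω + φ (σ ω))
    (hpos : ∀ᵐ ω ∂P, ω ∈ A → 0 < φ ω ∧ 0 < φ (σ ω)) :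
    P.real A ≤ ∫ ω, Real.sign (φ ω) ∂P := by
  have hint := integrable_sign_comp (P := P) hφ
  have hintσ : Integrable (fun ω => Real.sign (φ (σ ω))) P := hσ.integrable_comp_of_integrable hint
  have hinvariant : ∫ ω, Real.sign (φ (σ ω)) ∂P = ∫ ω, Real.sign (φ ω) ∂P := by
    conv_rhs => rw [← hσ.map_eq]
    exact (integral_map hσ.measurable.aemeasurable
      (measurable_sign.comp hφ).aestronglyMeasurable).symm
  have hle : ∫ ω, A.indicator (fun _ => 2) ω ∂P ≤
      ∫ ω, (Real.sign (φ ω) + Real.sign (φ (σ ω))) ∂P := by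
    refine integral_mono_ae ((integrable_const 2).indicator hA) (hint.add hintσ) ?_
    filter_upwards [hsum, hpos] with ω hω hωA
    by_cases hA : ω ∈ A
    · rw [Set.indicator_of_mem hA, Real.sign_of_pos (hωA hA).1, Real.sign_of_pos (hωA hA).2]
      norm_num
    · rw [Set.indicator_of_notMem hA]
      exact sign_add_sign_nonneg hω
  rw [integral_add hint hintσ, hinvariant, integral_indicator_const _ hA, smul_eq_mul] at hle
  linarith

/-- A law of multipliers favors larger values if, whenever a positive value and one that is
smaller by a fixed factor are multiplied by independent multipliers, the larger value stays ahead
more often than it falls behind, with a margin that depends only on the factor. -/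
def FavorsLarger (D : Measure ℝ) : Prop :=
  ∀ r, 0 < r → r < 1 → ∃ g > 0, ∀ t u : ℝ, 0 < t → 0 ≤ u → u ≤ r * t →
    g ≤ ∫ p, Real.sign (p.1 * t - p.2 * u) ∂(D.prod D)

variable {D : Measure ℝ}

theorem exists_Ioo_measure_pos_of_nonneg (hnonneg : ∀ᵐ x ∂D, 0 ≤ x)
    (hne : ¬ ∀ᵐ x ∂D, x = 0) {r : ℝ} (hr0 : 0 < r) (hr1 : r < 1) :
    ∃ a b : ℝ, r * b ≤ a ∧ 0 ≤ a ∧ 0 < D (Set.Ioo a b) := by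
  by_contra! hnull
  have hpos_null : D (Set.Ioi 0) = 0 := by
    refine measure_null_of_locally_null _ fun x (hx : 0 < x) =>
      ⟨Set.Ioo ((1 + r) / 2 * x) ((1 + r) / (2 * r) * x), mem_nhdsWithin_of_mem_nhds
        (Ioo_mem_nhds (by nlinarith) ?_), ?_⟩
    · rw [div_mul_eq_mul_div, lt_div_iff₀ (by positivity)]
      nlinarith
    · refine le_antisymm (hnull _ _ (le_of_eq ?_) (by positivity)) zero_le
      field_simp
  refine hne ?_
  filter_upwards [hnonneg, measure_eq_zero_iff_ae_notMem.1 hpos_null] with x hx hx'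
  exact le_antisymm (not_lt.1 hx') hx

variable [IsFiniteMeasure D]

theorem favorsLarger_of_nonneg (hnonneg : ∀ᵐ x ∂D, 0 ≤ x) (hne : ¬ ∀ᵐ x ∂D, x = 0) :
    FavorsLarger D := by
  intro r hr0 hr1
  obtain ⟨a, b, hab, ha, hD⟩ := exists_Ioo_measure_pos_of_nonneg hnonneg hne hr0 hr1
  set J := Set.Ioo a b
  have hJ : 0 < D.real J := ENNReal.toReal_pos hD.ne' (measure_ne_top _ _)
  refine ⟨(D.prod D).real (J ×ˢ J), by rw [measureReal_prod_prod]; positivity,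
    fun t u ht _ hut => ?_⟩
  have hut' : u ≤ t := hut.trans (mul_le_of_le_one_left ht.le hr1.le)
  have hahead : ∀ x ∈ J, ∀ y ∈ J, 0 < x * t - y * u := fun x hx y hy => by
    have : y * u < x * t := calc
      y * u ≤ y * (r * t) := mul_le_mul_of_nonneg_left hut (ha.trans hy.1.le)
      _ ≤ b * (r * t) := mul_le_mul_of_nonneg_right hy.2.le (by positivity)
      _ = r * b * t := by ring
      _ ≤ a * t := mul_le_mul_of_nonneg_right hab ht.le
      _ < x * t := mul_lt_mul_of_pos_right hx.1 ht
    linarith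
  refine measureReal_le_integral_sign Measure.measurePreserving_swap (by fun_prop)
    (measurableSet_Ioo.prod measurableSet_Ioo) ?_
    (ae_of_all _ fun p hp => ⟨hahead _ hp.1 _ hp.2, hahead _ hp.2 _ hp.1⟩)
  filter_upwards [Measure.quasiMeasurePreserving_fst.ae hnonneg,
    Measure.quasiMeasurePreserving_snd.ae hnonneg] with p hp1 hp2
  have : 0 ≤ (p.1 + p.2) * (t - u) := mul_nonneg (add_nonneg hp1 hp2) (by linarith)
  simp only [Prod.fst_swap, Prod.snd_swap]
  linarith

theorem favorsLarger_of_symmetric {m : ℝ} (hm : 0 < m)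
    (hsymm : MeasurePreserving (fun x => 2 * m - x) D D)
    (hsupp : ∀ ρ > 0, 0 < D (Set.Ioo (m - ρ) (m + ρ))) : FavorsLarger D := by
  intro r hr0 hr1
  set ρ := m * (1 - r) / 2 with hρ
  have hρ0 : 0 < ρ := half_pos (mul_pos hm (sub_pos.2 hr1))
  set J := Set.Ioo (m - ρ) (m + ρ)
  have hJ : 0 < D.real J := ENNReal.toReal_pos (hsupp ρ hρ0).ne' (measure_ne_top _ _)
  refine ⟨(D.prod D).real (J ×ˢ J), by rw [measureReal_prod_prod]; positivity,
    fun t u ht hu hut => ?_⟩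
  have hut' : u < t := by nlinarith
  have hahead : ∀ x ∈ J, ∀ y ∈ J, 0 < x * t - y * u := fun x hx y hy => by
    have : y * u < x * t := calc
      y * u ≤ (m + ρ) * u := mul_le_mul_of_nonneg_right hy.2.le hu
      _ ≤ (m + ρ) * (r * t) := mul_le_mul_of_nonneg_left hut (by positivity)
      _ ≤ (m - ρ) * t := by rw [hρ]; nlinarith [mul_pos (mul_pos hm ht) (sub_pos.2 hr1)]
      _ < x * t := mul_lt_mul_of_pos_right hx.1 ht
    linarith
  have hreflect : ∀ x ∈ J, 2 * m - x ∈ J := fun x hx =>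
    ⟨by linarith [hx.2], by linarith [hx.1]⟩
  refine measureReal_le_integral_sign (hsymm.prod hsymm) (by fun_prop)
    (measurableSet_Ioo.prod measurableSet_Ioo) (ae_of_all _ fun p => ?_)
    (ae_of_all _ fun p hp => ⟨hahead _ hp.1 _ hp.2,
      hahead _ (hreflect _ hp.1) _ (hreflect _ hp.2)⟩)
  have : 0 ≤ m * (t - u) := mul_nonneg hm.le (by linarith)
  simp only [Prod.map]
  linarith

theorem gaussianReal_Ioo_pos (m : ℝ) (v : ℝ≥0) {a b : ℝ} (ham : a < m) (hmb : m < b) :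
    0 < gaussianReal m v (Set.Ioo a b) := by
  rcases eq_or_ne v 0 with rfl | hv
  · rw [gaussianReal_zero_var, Measure.dirac_apply_of_mem (Set.mem_Ioo.2 ⟨ham, hmb⟩)]
    exact one_pos
  · refine pos_iff_ne_zero.2 fun hnull => ?_
    have := gaussianReal_absolutelyContinuous' m hv hnull
    rw [Real.volume_Ioo, ENNReal.ofReal_eq_zero] at this
    linarith

theorem IsMultiplierLaw.favorsLarger (hD : IsMultiplierLaw D) : FavorsLarger D := by
  rcases hD with ⟨hnonneg, hne⟩ | ⟨m, v, hm, rfl⟩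
  · exact favorsLarger_of_nonneg hnonneg hne
  · refine favorsLarger_of_symmetric hm ⟨by fun_prop, ?_⟩ fun ρ hρ =>
      gaussianReal_Ioo_pos m v (by linarith) (by linarith)
    rw [gaussianReal_map_const_sub, two_mul, add_sub_cancel_right]

end FavorsLarger

section Independence

variable {κ : Type*} [Fintype κ]

theorem indepFun_pi_of_dependsOn {X : κ → Type*} {F G : Type*}
    [MeasurableSpace F] [MeasurableSpace G] [∀ i, MeasurableSpace (X i)]
    {P : ∀ i, Measure (X i)} [∀ i, IsProbabilityMeasure (P i)] {S T : Finset κ}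
    (hST : Disjoint S T) {Y : (∀ i, X i) → F} {Z : (∀ i, X i) → G} (hY : Measurable Y)
    (hZ : Measurable Z) (hYS : DependsOn Y S) (hZT : DependsOn Z T) :
    IndepFun Y Z (Measure.pi P) := by
  classical
  have hcoord : iIndepFun (fun i (ξ : ∀ i, X i) => ξ i) (Measure.pi P) :=
    iIndepFun_pi (X := fun _ x => x) fun _ => aemeasurable_id
  obtain ⟨ξ₀⟩ : Nonempty (∀ i, X i) := (Measure.pi P).nonempty_of_neZero
  have hindep := (hcoord.indepFun_finset S T hST measurable_pi_apply).comp
    (hY.comp (measurable_updateFinset (x := ξ₀))) (hZ.comp (measurable_updateFinset (x := ξ₀)))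
  refine hindep.congr (ae_of_all _ fun ξ => hYS fun i hi => ?_)
    (ae_of_all _ fun ξ => hZT fun i hi => ?_) <;>
  exact dif_pos (Finset.mem_coe.1 hi)

variable {D : Measure ℝ} [IsProbabilityMeasure D]

theorem integral_comp_eval_pair {i j : κ} (hij : i ≠ j) {φ : ℝ × ℝ → ℝ} (hφ : Measurable φ) :
    ∫ ξ : κ → ℝ, φ (ξ i, ξ j) ∂(Measure.pi fun _ => D) = ∫ p, φ p ∂(D.prod D) := by
  have hcoord : iIndepFun (fun (i : κ) (ξ : κ → ℝ) => ξ i) (Measure.pi fun _ : κ => D) :=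
    iIndepFun_pi (μ := fun _ : κ => D) (X := fun _ x => x) fun _ => aemeasurable_id
  have hmap := (indepFun_iff_map_prod_eq_prod_map_map (measurable_pi_apply i).aemeasurable
    (measurable_pi_apply j).aemeasurable).1 (hcoord.indepFun hij)
  rw [(measurePreserving_eval (fun _ : κ => D) i).map_eq,
    (measurePreserving_eval (fun _ : κ => D) j).map_eq] at hmap
  rw [← hmap, integral_map (by fun_prop) hφ.aestronglyMeasurable]

variable {ι : Type*} {I : Finset ι} {s : ι → Finset κ} {Y : ι → (κ → ℝ) → ℝ}

theorem hasSubgaussianMGF_sum_of_dependsOn {c : ι → ℝ≥0}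
    (hdisj : (I : Set ι).PairwiseDisjoint s) (hmeas : ∀ i, Measurable (Y i))
    (hdep : ∀ i, DependsOn (Y i) (s i))
    (hY : ∀ i, HasSubgaussianMGF (Y i) (c i) (Measure.pi fun _ => D)) :
    HasSubgaussianMGF (fun ξ => ∑ i ∈ I, Y i ξ) (∑ i ∈ I, c i) (Measure.pi fun _ => D) := by
  classical
  induction I using Finset.induction_on with
  | empty => simp
  | insert i I hi ih =>
    rw [coe_insert, Set.pairwiseDisjoint_insert_of_notMem (mt Finset.mem_coe.1 hi)] at hdisj
    have hindep : IndepFun (Y i) (fun ξ => ∑ j ∈ I, Y j ξ) (Measure.pi fun _ => D) := by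
      refine indepFun_pi_of_dependsOn ((disjoint_biUnion_right _ _ _).2 hdisj.2) (hmeas i)
        (Finset.measurable_sum _ fun j _ => hmeas j) (hdep i) fun ξ η hξη => ?_
      exact sum_congr rfl fun j hj => hdep j fun a ha =>
        hξη a (Finset.mem_coe.2 (mem_biUnion.2 ⟨j, hj, ha⟩))
    simp only [sum_insert hi]
    exact (hY i).add_of_indepFun (ih hdisj.1) hindep

theorem measureReal_sum_nonpos_le_of_dependsOn
    (hdisj : (I : Set ι).PairwiseDisjoint s) (hmeas : ∀ i, Measurable (Y i))
    (hdep : ∀ i, DependsOn (Y i) (s i)) (hY : ∀ i ξ, Y i ξ ∈ Set.Icc (-1) 1) {g : ℝ} (hg : 0 ≤ g)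
    (hmean : ∀ i ∈ I, g ≤ ∫ ξ, Y i ξ ∂(Measure.pi fun _ => D)) :
    (Measure.pi fun _ : κ => D).real {ξ | ∑ i ∈ I, Y i ξ ≤ 0} ≤ Real.exp (-(g ^ 2 * #I / 2)) := by
  set P := Measure.pi fun _ : κ => D
  have hcentered : ∀ i, HasSubgaussianMGF (fun ξ => -(Y i ξ - P[Y i])) 1 P := fun i => by
    have hnorm : (‖(1 : ℝ) - -1‖₊ / 2) ^ 2 = 1 := by norm_num
    exact hnorm ▸ (hasSubgaussianMGF_of_mem_Icc (μ := P) (hmeas i).aemeasurable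
      (ae_of_all _ (hY i))).neg
  have htail := (hasSubgaussianMGF_sum_of_dependsOn (Y := fun i ξ => -(Y i ξ - P[Y i])) hdisj
    (fun i => ((hmeas i).sub_const _).neg)
    (fun i ξ η hξη => by simp only [hdep i hξη]) hcentered).measure_ge_le (ε := g * #I)
    (by positivity)
  refine (measureReal_mono ?_ (measure_ne_top _ _)).trans
    (htail.trans (Real.exp_le_exp.2 (le_of_eq ?_)))
  · intro ξ hξ
    rw [Set.mem_ofPred_eq] at hξ ⊢
    rw [sum_neg_distrib, sum_sub_distrib]
    have := card_nsmul_le_sum I _ _ hmean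
    rw [nsmul_eq_mul] at this
    linarith
  · rcases I.eq_empty_or_nonempty with rfl | hI
    · simp
    · have : (0 : ℝ) < #I := by exact_mod_cast hI.card_pos
      simp only [sum_const, nsmul_eq_mul, mul_one, NNReal.coe_natCast]
      field_simp

end Independence

instance isProbabilityMeasure_noiseLaw (N : Type*) [Fintype N] (D : Measure ℝ)
    [IsProbabilityMeasure D] : IsProbabilityMeasure (noiseLaw N D) := by
  unfold noiseLaw
  infer_instance

section DisjointUnion

variable {N : Type*} [DecidableEq N] {T U A X Y : Finset N}

theorem eq_of_union_eq_union_of_disjoint (hT : Disjoint A T) (hU : Disjoint A U) (hX : X ⊆ A)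
    (hY : Y ⊆ A) (h : T ∪ X = U ∪ Y) : X = Y := by
  have hrecover : ∀ {V Z : Finset N}, Disjoint A V → Z ⊆ A → (V ∪ Z) ∩ A = Z := fun hV hZ => by
    rw [union_inter_distrib_right, disjoint_iff_inter_eq_empty.1 hV.symm, empty_union,
      inter_eq_left.2 hZ]
  rw [← hrecover hT hX, h, hrecover hU hY]

theorem pairwiseDisjoint_pair_union (hA : Disjoint A (T ∪ U)) :
    (A.powerset : Set (Finset N)).PairwiseDisjoint fun X => ({T ∪ X, U ∪ X} : Finset _) := by
  intro X hX Y hY hXY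
  rw [Finset.mem_coe, mem_powerset] at hX hY
  obtain ⟨hT, hU⟩ := disjoint_union_right.1 hA
  simp only [Function.onFun, disjoint_insert_left, disjoint_singleton_left, mem_insert,
    mem_singleton, not_or]
  exact ⟨⟨fun h => hXY (eq_of_union_eq_union_of_disjoint hT hT hX hY h),
    fun h => hXY (eq_of_union_eq_union_of_disjoint hT hU hX hY h)⟩,
    fun h => hXY (eq_of_union_eq_union_of_disjoint hU hT hX hY h),
    fun h => hXY (eq_of_union_eq_union_of_disjoint hU hU hX hY h)⟩

end DisjointUnion

section MajorityVote

variable {N : Type*} [LinearOrder N]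

theorem wins_sub_wins_eq_sum_sign (q : Finset N → ℝ) (T U A : Finset N) :
    (wins q T U A : ℝ) - wins q U T A =
      ∑ X ∈ A.powerset, Real.sign (q (T ∪ X) - q (U ∪ X)) := by
  simp only [wins, card_filter, Nat.cast_sum, ← sum_sub_distrib]
  refine sum_congr rfl fun X _ => ?_
  rcases lt_trichotomy (q (T ∪ X)) (q (U ∪ X)) with h | h | h
  · rw [Real.sign_of_neg (sub_neg.2 h), if_neg h.not_ge, if_pos h.le]
    norm_num
  · simp [h]
  · rw [Real.sign_of_pos (sub_pos.2 h), if_pos h.le, if_neg h.not_ge]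
    norm_num

variable [Fintype N] {D : Measure ℝ} [IsProbabilityMeasure D]

theorem measureReal_not_detectsBetter_le {f : Finset N → ℝ} (hm : Monotone f) (h0 : 0 ≤ f ∅)
    {g r : ℝ} (hg : 0 ≤ g) (hr1 : r < 1)
    (hgap : ∀ t u : ℝ, 0 < t → 0 ≤ u → u ≤ r * t →
      g ≤ ∫ p, Real.sign (p.1 * t - p.2 * u) ∂(D.prod D))
    {T U A : Finset N} (hA : Disjoint A (T ∪ U)) :
    (noiseLaw N D).real {ξ | ¬ DetectsBetter (noisyOracle f ξ) f r T U A} ≤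
      Real.exp (-(g ^ 2 * 2 ^ #A / 2)) := by
  by_cases h : 0 < f T ∧ ∀ X ⊆ A, f (U ∪ X) ≤ r * f (T ∪ X)
  swap
  · have : {ξ | ¬ DetectsBetter (noisyOracle f ξ) f r T U A} = ∅ :=
      Set.eq_empty_of_forall_notMem fun ξ hξ => hξ fun hT hr => (h ⟨hT, hr⟩).elim
    rw [this, measureReal_empty]
    positivity
  obtain ⟨hT, hr⟩ := h
  have hpos : ∀ X, 0 < f (T ∪ X) := fun X => hT.trans_le (hm subset_union_left)
  have hne : ∀ X ⊆ A, T ∪ X ≠ U ∪ X := fun X hX e => by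
    have := hr X hX
    rw [← e] at this
    nlinarith [hpos X]
  set Y : Finset N → (Finset N → ℝ) → ℝ := fun X ξ =>
    Real.sign (noisyOracle f ξ (T ∪ X) - noisyOracle f ξ (U ∪ X))
  have hmean : ∀ X ∈ A.powerset, g ≤ ∫ ξ, Y X ξ ∂(noiseLaw N D) := fun X hX => by
    have hX := mem_powerset.1 hX
    refine (hgap _ _ (hpos X) (h0.trans (hm (empty_subset _))) (hr X hX)).trans_eq ?_
    exact (integral_comp_eval_pair (hne X hX)
      (measurable_sign.comp (by fun_prop))).symm
  have hoeffding := measureReal_sum_nonpos_le_of_dependsOn (D := D) (Y := Y)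
    (pairwiseDisjoint_pair_union hA)
    (fun X => measurable_sign.comp (by unfold noisyOracle; fun_prop))
    (fun X ξ η hξη => by
      simp only [Y, noisyOracle, hξη (T ∪ X) (by simp), hξη (U ∪ X) (by simp)])
    (fun X ξ => sign_mem_Icc _) hg hmean
  rw [card_powerset, Nat.cast_pow, Nat.cast_ofNat] at hoeffding
  refine (measureReal_mono ?_ (measure_ne_top _ _)).trans hoeffding
  intro ξ hξ
  rw [Set.mem_ofPred_eq] at hξ ⊢
  rw [← wins_sub_wins_eq_sum_sign, sub_nonpos]
  exact_mod_cast not_lt.1 fun hwins => hξ fun _ _ => hwins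

end MajorityVote

section UnionBound

theorem measureReal_exists_mem_le {Ω ι : Type*} {_ : MeasurableSpace Ω} {P : Measure Ω}
    [IsFiniteMeasure P] {I : Finset ι} {p : ι → Ω → Prop} {δ : ℝ}
    (h : ∀ i ∈ I, P.real {ω | p i ω} ≤ δ) : P.real {ω | ∃ i ∈ I, p i ω} ≤ #I * δ := by
  have hunion : {ω | ∃ i ∈ I, p i ω} = ⋃ i ∈ I, {ω | p i ω} := by
    ext ω
    simp
  rw [hunion, ← nsmul_eq_mul]
  exact (measureReal_biUnion_finset_le _ _).trans (sum_le_card_nsmul _ _ _ h)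

theorem one_sub_le_measureReal_of_forall_or {Ω : Type*} {_ : MeasurableSpace Ω} {P : Measure Ω}
    [IsProbabilityMeasure P] {p q r : Ω → Prop} {δ : ℝ} (h : ∀ ω, p ω ∨ q ω ∨ r ω)
    (hδ : P.real {ω | q ω} + P.real {ω | r ω} ≤ δ) : 1 - δ ≤ P.real {ω | p ω} := by
  have htotal : P.real ({ω | p ω} ∪ ({ω | q ω} ∪ {ω | r ω})) = 1 := by
    simp only [← Set.ofPred_or, h, Set.ofPred_true, probReal_univ]
  linarith [measureReal_union_le (μ := P) {ω | p ω} ({ω | q ω} ∪ {ω | r ω}),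
    measureReal_union_le (μ := P) {ω | q ω} {ω | r ω}]

theorem card_filter_card_le_pow (N : Type*) [Fintype N] (k : ℕ) :
    #{S : Finset N | #S ≤ k} ≤ (Fintype.card N + 1) ^ k := by
  classical
  induction k with
  | zero => simp [filter_eq']
  | succ k ih =>
    have hcover : ({S : Finset N | #S ≤ k + 1} : Finset (Finset N)) ⊆
        ((univ : Finset (Option N)) ×ˢ ({S : Finset N | #S ≤ k} : Finset (Finset N))).image
          fun p => p.1.elim p.2 fun a => insert a p.2 := fun S hS => by
      have hS := (mem_filter.1 hS).2
      rcases S.eq_empty_or_nonempty with rfl | ⟨a, ha⟩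
      · exact mem_image.2 ⟨(none, ∅), by simp, rfl⟩
      · refine mem_image.2 ⟨(some a, S.erase a), ?_, insert_erase ha⟩
        simp only [mem_product, mem_univ, mem_filter, true_and, card_erase_of_mem ha]
        omega
    refine (card_le_card hcover).trans (card_image_le.trans ?_)
    rw [card_product, card_univ, Fintype.card_option, pow_succ']
    exact Nat.mul_le_mul_left _ ih

end UnionBound

section Reliability

theorem smoothAvg_noisyOracle_sub {N : Type*} [DecidableEq N] (f : Finset N → ℝ)
    {V H : Finset N} (hV : Disjoint V H) (ξ : Finset N → ℝ) (μ : ℝ) :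
    smoothAvg (noisyOracle f ξ) H V - μ * smoothAvg f H V =
      (∑ S ∈ H.powerset.image (V ∪ ·), f S * (ξ S - μ)) / 2 ^ #H := by
  rw [sum_image fun X hX Y hY => eq_of_union_eq_union_of_disjoint hV.symm hV.symm
    (mem_powerset.1 hX) (mem_powerset.1 hY), smoothAvg, smoothAvg, sum_div, mul_sum, mul_sum,
    mul_sum, ← sum_sub_distrib]
  refine sum_congr rfl fun X _ => ?_
  rw [noisyOracle]
  ring

variable {N : Type*} [Fintype N] [LinearOrder N] {D : Measure ℝ} [IsProbabilityMeasure D]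
  {f : Finset N → ℝ} {k : ℕ}

theorem IsSubexponential.measureReal_smoothAvg_far_le {K r τ : ℝ} (hD : IsSubexponential D K r)
    (hK : 0 < K) (hm : Monotone f) (h0 : 0 ≤ f ∅) (hW : 0 < optValue f k) (hτ : 0 ≤ τ)
    (hτr : τ ≤ 2 * K * r) {V H : Finset N} (hV : Disjoint V H) (hVk : #(V ∪ H) ≤ k) :
    (noiseLaw N D).real {ξ | ¬ |smoothAvg (noisyOracle f ξ) H V - (∫ x, x ∂D) * smoothAvg f H V| ≤
        τ * optValue f k} ≤ 2 * Real.exp (-(τ ^ 2 * 2 ^ #H / (4 * K))) := by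
  set I := H.powerset.image (V ∪ ·) with hI
  have hcard : (#I : ℝ) = 2 ^ #H := by
    rw [hI, card_image_of_injOn fun X hX Y hY => eq_of_union_eq_union_of_disjoint hV.symm hV.symm
      (mem_powerset.1 hX) (mem_powerset.1 hY), card_powerset, Nat.cast_pow, Nat.cast_ofNat]
  have hbound : ∀ S ∈ I, |f S| ≤ optValue f k := fun S hS => by
    obtain ⟨X, hX, rfl⟩ := mem_image.1 hS
    rw [abs_of_nonneg (h0.trans (hm (empty_subset _)))]
    exact le_optValue f
      ((card_le_card (union_subset_union_right (mem_powerset.1 hX))).trans hVk)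
  have hconc := hD.measureReal_abs_sum_gt_le hK hW hτ hτr hbound
  rw [hcard] at hconc
  refine (measureReal_mono (fun ξ hξ => ?_) (measure_ne_top _ _)).trans hconc
  have hpow : (0 : ℝ) < 2 ^ #H := by positivity
  rw [Set.mem_ofPred_eq] at hξ ⊢
  rwa [smoothAvg_noisyOracle_sub f hV, abs_div, abs_of_pos hpow, not_le, lt_div_iff₀ hpow] at hξ

theorem IsSubexponential.measureReal_not_smoothClose_le {K r η : ℝ}
    (hD : IsSubexponential D K r) (hK : 0 < K) (hm : Monotone f) (h0 : 0 ≤ f ∅)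
    (hW : 0 < optValue f k) (hη : 0 ≤ (∫ x, x ∂D) * η) (hηr : (∫ x, x ∂D) * η ≤ 2 * K * r)
    (H : Finset N) :
    (noiseLaw N D).real
        {ξ | ¬ SmoothClose (noisyOracle f ξ) f (∫ x, x ∂D) (η * optValue f k) k H} ≤
      (Fintype.card N + 1) ^ k *
        (2 * Real.exp (-(((∫ x, x ∂D) * η) ^ 2 * 2 ^ #H / (4 * K)))) := by
  have hunion := measureReal_exists_mem_le (P := noiseLaw N D)
    (I := ({V | Disjoint V H ∧ #(V ∪ H) ≤ k} : Finset (Finset N))) fun V hV =>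
      hD.measureReal_smoothAvg_far_le hK hm h0 hW hη hηr (mem_filter.1 hV).2.1 (mem_filter.1 hV).2.2
  refine (measureReal_mono (fun ξ hξ => ?_) (measure_ne_top _ _)).trans
    (hunion.trans (mul_le_mul_of_nonneg_right ?_ (by positivity)))
  · simp only [Set.mem_ofPred_eq, SmoothClose, not_forall] at hξ
    obtain ⟨V, hV, hVk, hfar⟩ := hξ
    exact ⟨V, mem_filter.2 ⟨mem_univ V, hV, hVk⟩, by rwa [mul_assoc]⟩
  · have hsmall : ∀ V ∈ (univ : Finset (Finset N)), Disjoint V H ∧ #(V ∪ H) ≤ k → #V ≤ k :=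
      fun V _ hV => (card_le_card subset_union_left).trans hV.2
    exact_mod_cast (card_le_card (monotone_filter_right univ hsmall)).trans
      (card_filter_card_le_pow N k)

theorem measureReal_not_comparesWell_le (hm : Monotone f) (h0 : 0 ≤ f ∅) {g r : ℝ} (hg : 0 ≤ g)
    (hr1 : r < 1)
    (hgap : ∀ t u : ℝ, 0 < t → 0 ≤ u → u ≤ r * t →
      g ≤ ∫ p, Real.sign (p.1 * t - p.2 * u) ∂(D.prod D))
    (l : ℕ) (C : Finset N → Finset N → Finset N) :
    (noiseLaw N D).real {ξ | ¬ ComparesWell (noisyOracle f ξ) f r k l C} ≤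
      ((Fintype.card N + 1) ^ k) ^ 2 * (2 * Real.exp (-(g ^ 2 * 2 ^ l / 2))) := by
  set Q : Finset (Finset N) := {S | #S ≤ k}
  set I := {p ∈ Q ×ˢ Q | Disjoint (C p.1 p.2) (p.1 ∪ p.2) ∧ #(C p.1 p.2) = l}
  have hpair : ∀ p ∈ I, (noiseLaw N D).real
      {ξ | ¬ (DetectsBetter (noisyOracle f ξ) f r p.1 p.2 (C p.1 p.2) ∧
        DetectsBetter (noisyOracle f ξ) f r p.2 p.1 (C p.1 p.2))} ≤
      2 * Real.exp (-(g ^ 2 * 2 ^ l / 2)) := fun p hp => by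
    obtain ⟨hdisj, rfl⟩ := (mem_filter.1 hp).2
    simp only [not_and_or, Set.ofPred_or]
    refine (measureReal_union_le _ _).trans ((add_le_add
      (measureReal_not_detectsBetter_le hm h0 hg hr1 hgap hdisj)
      (measureReal_not_detectsBetter_le hm h0 hg hr1 hgap ?_)).trans_eq (two_mul _).symm)
    rwa [union_comm]
  refine (measureReal_mono (fun ξ hξ => ?_) (measure_ne_top _ _)).trans
    ((measureReal_exists_mem_le hpair).trans (mul_le_mul_of_nonneg_right ?_ (by positivity)))
  · simp only [Set.mem_ofPred_eq, ComparesWell, not_forall] at hξ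
    obtain ⟨T, U, hT, hU, hdisj, hcard, hwrong⟩ := hξ
    exact ⟨(T, U), mem_filter.2 ⟨mem_product.2 ⟨mem_filter.2 ⟨mem_univ T, hT⟩,
      mem_filter.2 ⟨mem_univ U, hU⟩⟩, hdisj, hcard⟩, hwrong⟩
  · have hI_card : #I ≤ #Q ^ 2 := by
      rw [sq, ← card_product]
      exact card_filter_le _ _
    exact_mod_cast hI_card.trans (Nat.pow_le_pow_left (card_filter_card_le_pow N k) 2)

end Reliability

section Numerics

theorem one_le_logb_two_logb_two {x : ℝ} (hx : 2 ≤ Real.logb 2 x) :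
    1 ≤ Real.logb 2 (Real.logb 2 x) := by
  rw [Real.le_logb_iff_rpow_le one_lt_two (by linarith), Real.rpow_one]
  exact hx

theorem smoothingSize_le {ε : ℝ} (hε : 0 < ε) {n k : ℕ} (hn : 2 ≤ Real.logb 2 n)
    (hk : 3168 * Real.logb 2 (Real.logb 2 n) / ε ^ 2 ≤ k) :
    (smoothingSize ε n k : ℝ) ≤ ε ^ 2 / 92 * k := by
  have hloglog := one_le_logb_two_logb_two hn
  rw [smoothingSize]
  split_ifs with h
  · have := Nat.ceil_lt_add_one (by linarith : 0 ≤ 25 * Real.logb 2 n)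
    rw [div_le_iff₀ (by positivity)] at h
    linarith
  · have := Nat.ceil_lt_add_one (by linarith : 0 ≤ 33 * Real.logb 2 (Real.logb 2 n))
    rw [div_le_iff₀ (by positivity)] at hk
    linarith

theorem pow_le_two_pow_ceil_logb {x : ℝ} (hx : 0 < x) (a : ℕ) :
    x ^ a ≤ (2 : ℝ) ^ ⌈a * Real.logb 2 x⌉₊ := by
  rw [← Real.rpow_natCast 2, ← Real.logb_le_iff_le_rpow one_lt_two (pow_pos hx a),
    Real.logb_pow]
  exact Nat.le_ceil _

theorem logb_two_natCast_le (n : ℕ) : Real.logb 2 n ≤ n := by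
  rcases Nat.eq_zero_or_pos n with rfl | hn
  · simp
  rw [Real.logb_le_iff_le_rpow one_lt_two (by exact_mod_cast hn), Real.rpow_natCast]
  exact_mod_cast n.lt_two_pow_self.le

theorem log_add_one_le_two_mul_logb_two {x : ℝ} (hx : 2 ≤ x) :
    Real.log (x + 1) ≤ 2 * Real.logb 2 x := by
  have hlog : Real.log x ≤ Real.logb 2 x := by
    rw [Real.logb]
    exact le_div_self (Real.log_nonneg (by linarith)) (Real.log_pos one_lt_two)
      (Real.log_two_lt_d9.le.trans (by norm_num))
  calc Real.log (x + 1) ≤ Real.log (x ^ 2) := Real.log_le_log (by linarith) (by nlinarith)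
    _ = 2 * Real.log x := by rw [Real.log_pow, Nat.cast_ofNat]
    _ ≤ 2 * Real.logb 2 x := by gcongr

-- The scale is `n` for large `k` and `logb 2 n` for small `k`: the two cases in the choice of `ℓ`.
theorem exists_scale {ε : ℝ} (hε : 0 < ε) (hε1 : ε ≤ 1) {n k : ℕ} (hn : 2 ≤ Real.logb 2 n)
    (hkn : k ≤ n) :
    ∃ u : ℝ, Real.logb 2 n ≤ u ∧ (k : ℝ) ≤ 2400 / ε ^ 2 * u ∧ Real.log (n + 1) ≤ 2 * u ∧
      u ^ 25 ≤ (2 : ℝ) ^ smoothingSize ε n k := by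
  have hlogn := logb_two_natCast_le n
  have hlog := log_add_one_le_two_mul_logb_two (hn.trans hlogn)
  rw [smoothingSize]
  split_ifs with h
  · refine ⟨n, hlogn, ?_, by linarith,
      by exact_mod_cast pow_le_two_pow_ceil_logb (x := n) (by linarith) 25⟩
    have hε2 : 1 ≤ 2400 / ε ^ 2 := by
      rw [one_le_div (by positivity)]
      nlinarith
    exact (Nat.cast_le.2 hkn).trans (le_mul_of_one_le_left (Nat.cast_nonneg n) hε2)
  · refine ⟨Real.logb 2 n, le_rfl, ?_, hlog, ?_⟩
    · rw [div_mul_eq_mul_div]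
      exact (not_le.1 h).le
    · refine (pow_le_pow_right₀ (by linarith) (by norm_num : 25 ≤ 33)).trans ?_
      exact_mod_cast pow_le_two_pow_ceil_logb (x := Real.logb 2 n) (by linarith) 33

theorem mul_sq_le_div_sq_mul_two_pow {A B c u : ℝ} {k l : ℕ} (hA : 0 < A) (hc : 0 ≤ c)
    (hu : 1 ≤ u) (hk0 : 0 < k) (hk : k ≤ A * u) (hB : B ≤ c / A ^ 2 * u)
    (hl : u ^ 25 ≤ (2 : ℝ) ^ l) : B * u ^ 2 ≤ c / k ^ 2 * 2 ^ l := by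
  have : 0 < u := one_pos.trans_le hu
  have : (0 : ℝ) < k := Nat.cast_pos.2 hk0
  calc B * u ^ 2 ≤ c / A ^ 2 * u * u ^ 2 := by gcongr
    _ = c / (A * u) ^ 2 * u ^ 5 := by field_simp
    _ ≤ c / k ^ 2 * u ^ 25 := by
        gcongr
        norm_num
    _ ≤ c / k ^ 2 * 2 ^ l := by gcongr

theorem mul_sq_le_mul_two_pow {B c u : ℝ} {l : ℕ} (hc : 0 ≤ c) (hu : 1 ≤ u) (hB : B ≤ c * u)
    (hl : u ^ 25 ≤ (2 : ℝ) ^ l) : B * u ^ 2 ≤ c * 2 ^ l :=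
  calc B * u ^ 2 ≤ c * u * u ^ 2 := by gcongr
    _ = c * u ^ 3 := by ring
    _ ≤ c * u ^ 25 := by
        gcongr
        norm_num
    _ ≤ c * 2 ^ l := by gcongr

theorem add_one_pow_le_exp {A u : ℝ} {n k : ℕ} (hk : k ≤ A * u)
    (hn : Real.log (n + 1) ≤ 2 * u) : ((n : ℝ) + 1) ^ k ≤ Real.exp (2 * A * u ^ 2) := by
  have hlog : 0 ≤ Real.log ((n : ℝ) + 1) := Real.log_nonneg (by simp)
  rw [← Real.log_le_iff_le_exp (by positivity), Real.log_pow]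
  calc (k : ℝ) * Real.log (n + 1) ≤ A * u * (2 * u) :=
        mul_le_mul hk hn hlog (k.cast_nonneg.trans hk)
    _ = 2 * A * u ^ 2 := by ring

theorem union_bound_le_one_div {A u x y : ℝ} {m n k : ℕ} (hu : 1 ≤ u) (hn0 : 0 < n)
    (hk : k ≤ A * u) (hn : Real.log (n + 1) ≤ 2 * u) (hx : (4 * A + 2 * m + 4) * u ^ 2 ≤ x)
    (hy : (4 * A + 2 * m + 4) * u ^ 2 ≤ y) :
    m * (((n : ℝ) + 1) ^ k * (2 * Real.exp (-x))) +
      (((n : ℝ) + 1) ^ k) ^ 2 * (2 * Real.exp (-y)) ≤ 1 / n := by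
  have hnR : (0 : ℝ) < n := Nat.cast_pos.2 hn0
  set M := ((n : ℝ) + 1) ^ k
  set v := (4 * A + 2 * m + 4) * u ^ 2 with hv
  have hM1 : 1 ≤ M := one_le_pow₀ (by linarith)
  have hM : M ≤ Real.exp (2 * A * u ^ 2) := add_one_pow_le_exp hk hn
  have hm : 2 * m + 2 ≤ Real.exp ((2 * m + 2) * u ^ 2) := by
    have : (2 * m + 2 : ℝ) * 1 ≤ (2 * m + 2) * u ^ 2 := by gcongr; exact one_le_pow₀ hu
    linarith [Real.add_one_le_exp ((2 * m + 2 : ℝ) * u ^ 2)]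
  have hn_exp : (n : ℝ) ≤ Real.exp (2 * u) := by
    linarith [(Real.log_le_iff_le_exp (by positivity : (0 : ℝ) < (n : ℝ) + 1)).1 hn]
  calc m * (M * (2 * Real.exp (-x))) + M ^ 2 * (2 * Real.exp (-y))
      ≤ m * (M ^ 2 * (2 * Real.exp (-v))) + M ^ 2 * (2 * Real.exp (-v)) := by
        gcongr
        exact le_self_pow₀ hM1 two_ne_zero
    _ = (2 * m + 2) * (M ^ 2 * Real.exp (-v)) := by ring
    _ ≤ Real.exp ((2 * m + 2) * u ^ 2) * (Real.exp (2 * A * u ^ 2) ^ 2 * Real.exp (-v)) := by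
        gcongr
    _ = Real.exp (-(2 * u ^ 2)) := by
        rw [hv, ← Real.exp_nat_mul, ← Real.exp_add, ← Real.exp_add]
        congr 1
        push_cast
        ring
    _ ≤ Real.exp (-(2 * u)) := by
        gcongr
        exact le_self_pow₀ hu two_ne_zero
    _ ≤ 1 / n := by
        rw [Real.exp_neg, ← one_div]
        exact one_div_le_one_div_of_le hnR hn_exp

end Numerics

section Guarantee

variable {N : Type*} [Fintype N] [LinearOrder N] {D : Measure ℝ} [IsProbabilityMeasure D]
  {f : Finset N → ℝ} {ε : ℝ} {k l m : ℕ} {H : Fin m → Finset N}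
  {C : Finset N → Finset N → Finset N}

theorem IsSubexponential.measureReal_exists_not_smoothClose_le {K r : ℝ}
    (hD : IsSubexponential D K r) (hK : 0 < K) (hμ : 0 ≤ ∫ x, x ∂D)
    (hKr : ∫ x, x ∂D ≤ 2 * K * r) (hε : 0 ≤ ε) (hε1 : ε ≤ 1) (hk : 0 < k) (hm : Monotone f)
    (h0 : 0 ≤ f ∅) (hW : 0 < optValue f k) (hH : IsSmoothingFamily H l) :
    (noiseLaw N D).real {ξ | ∃ j, ¬ SmoothClose (noisyOracle f ξ) f (∫ x, x ∂D)
        (ε / (100 * k) * optValue f k) k (H j)} ≤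
      m * ((Fintype.card N + 1) ^ k *
        (2 * Real.exp (-(((∫ x, x ∂D) * (ε / 100)) ^ 2 / (4 * K) / k ^ 2 * 2 ^ l)))) := by
  have hk1 : (1 : ℝ) ≤ k := Nat.one_le_cast.2 hk
  have hη1 : ε / (100 * k) ≤ 1 := by
    rw [div_le_one (by positivity)]
    linarith
  have hone : ∀ j ∈ (univ : Finset (Fin m)), (noiseLaw N D).real
      {ξ | ¬ SmoothClose (noisyOracle f ξ) f (∫ x, x ∂D) (ε / (100 * k) * optValue f k) k (H j)} ≤
      (Fintype.card N + 1) ^ k *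
        (2 * Real.exp (-(((∫ x, x ∂D) * (ε / 100)) ^ 2 / (4 * K) / k ^ 2 * 2 ^ l))) := by
    intro j _
    refine (hD.measureReal_not_smoothClose_le hK hm h0 hW (by positivity)
      ((mul_le_of_le_one_right hμ hη1).trans hKr) (H j)).trans_eq ?_
    rw [hH.card_eq]
    congr 4
    field_simp
  simpa using measureReal_exists_mem_le hone

theorem exists_reliable_threshold (hε : 0 < ε) (hε1 : ε ≤ 1)
    (hint : 0 ∈ interior (integrableExpSet id D)) (hμ : 0 < ∫ x, x ∂D) (hD : FavorsLarger D) :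
    ∃ u₀ ≥ 2, ∀ (N : Type*) [Fintype N] [LinearOrder N] (f : Finset N → ℝ) (k l : ℕ)
      (H : Fin (numSets ε) → Finset N) (C : Finset N → Finset N → Finset N),
      u₀ ≤ Real.logb 2 (Fintype.card N) → 0 < k → k ≤ Fintype.card N →
      l = smoothingSize ε (Fintype.card N) k → Monotone f → 0 ≤ f ∅ → 0 < optValue f k →
      IsSmoothingFamily H l →
      (noiseLaw N D).real {ξ | ∃ j, ¬ SmoothClose (noisyOracle f ξ) f (∫ x, x ∂D)
          (ε / (100 * k) * optValue f k) k (H j)} +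
        (noiseLaw N D).real {ξ | ¬ ComparesWell (noisyOracle f ξ) f (1 - ε ^ 2 / 80 / 2) k l C} ≤
      1 / Fintype.card N := by
  obtain ⟨K₀, hK₀, r, hr, hsub⟩ := exists_isSubexponential hint
  have hρ1 : 1 - ε ^ 2 / 80 / 2 < 1 := by linarith [pow_pos hε 2]
  obtain ⟨g, hg, hgap⟩ := hD (1 - ε ^ 2 / 80 / 2) (by nlinarith) hρ1
  set K := K₀ + (∫ x, x ∂D) / (2 * r)
  have hK : 0 < K := by positivity
  have hKr : ∫ x, x ∂D ≤ 2 * K * r :=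
    calc ∫ x, x ∂D ≤ 2 * K₀ * r + ∫ x, x ∂D := le_add_of_nonneg_left (by positivity)
      _ = 2 * K * r := by simp only [K]; field_simp
  set A := 2400 / ε ^ 2
  set B := 4 * A + 2 * (numSets ε : ℝ) + 4
  set c₁ := ((∫ x, x ∂D) * (ε / 100)) ^ 2 / (4 * K)
  have hA : 0 < A := by positivity
  have hc₁ : 0 < c₁ := by positivity
  refine ⟨max 2 (max (B / (c₁ / A ^ 2)) (B / (g ^ 2 / 2))), le_max_left _ _,
    fun N _ _ f k l H C hN hk hkN hl hm h0 hW hH => ?_⟩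
  simp only [max_le_iff] at hN
  obtain ⟨u, hNu, hku, hlog, hpow⟩ := exists_scale hε hε1 hN.1 hkN
  rw [← hl] at hpow
  have hu : 1 ≤ u := by linarith
  have hB₁ : B ≤ c₁ / A ^ 2 * u :=
    (div_le_iff₀' (by positivity)).1 (hN.2.1.trans hNu)
  have hB₂ : B ≤ g ^ 2 / 2 * u :=
    (div_le_iff₀' (by positivity)).1 (hN.2.2.trans hNu)
  refine (add_le_add ((hsub.mono (le_add_of_nonneg_right (by positivity))
    ).measureReal_exists_not_smoothClose_le hK hμ.le hKr hε.le hε1 hk hm h0 hW hH)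
    (measureReal_not_comparesWell_le hm h0 hg.le hρ1 hgap l C)).trans ?_
  refine union_bound_le_one_div hu (hk.trans_le hkN) hku hlog
    (mul_sq_le_div_sq_mul_two_pow hA hc₁.le hu hk hku hB₁ hpow) ?_
  rw [← div_mul_eq_mul_div]
  exact mul_sq_le_mul_two_pow (by positivity) hu hB₂ hpow

theorem IsSmoothingFamily.le_slickGreedy_of_card_le (hH : IsSmoothingFamily H l)
    (q : Finset N → ℝ) (hm0 : 0 < m) (hmlk : m * l ≤ k) (hN : Fintype.card N ≤ k)
    (hm : Monotone f) : optValue f k ≤ f (slickGreedy q k H C) := by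
  obtain ⟨j, hj⟩ := exists_slickGreedy_eq_candidate q k H C hm0
  obtain ⟨O, -, hO⟩ := exists_eq_optValue f k
  rw [hj, hH.candidate_eq_univ q hmlk hN j, ← hO]
  exact hm (subset_univ O)

theorem IsSmoothingFamily.one_sub_le_measureReal_slickGreedy {Ω : Type*} {_ : MeasurableSpace Ω}
    {P : Measure Ω} [IsProbabilityMeasure P] {q : Ω → Finset N → ℝ} {μ δ : ℝ}
    (hH : IsSmoothingFamily H l) (hC : IsComparisonRule C l) (hε : 0 < ε) (hε1 : ε ≤ 1)
    (hεm : 6 ≤ ε * m ∧ ε * m ≤ 7) (hk : 0 < k) (hl : (l : ℝ) ≤ ε ^ 2 / 92 * k) (hm0 : 0 < m)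
    (hmlk : m * l ≤ k) (hμ : 0 < μ) (hf : IsSubmodular f) (hm : Monotone f) (h0 : 0 ≤ f ∅)
    (hδ : 0 ≤ δ) (hbad : k ≤ Fintype.card N → 0 < optValue f k →
      P.real {ω | ∃ j, ¬ SmoothClose (q ω) f μ (ε / (100 * k) * optValue f k) k (H j)} +
        P.real {ω | ¬ ComparesWell (q ω) f (1 - ε ^ 2 / 80 / 2) k l C} ≤ δ) :
    1 - δ ≤ P.real {ω | HasComparisonRoom (q ω) k l H → #(slickGreedy (q ω) k H C) ≤ k ∧
      (1 - 1 / Real.exp 1 - ε) * optValue f k ≤ f (slickGreedy (q ω) k H C)} := by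
  have hcard : ∀ ω, #(slickGreedy (q ω) k H C) ≤ k := fun ω => by
    obtain ⟨j, hj⟩ := exists_slickGreedy_eq_candidate (q ω) k H C hm0
    exact hj ▸ hH.card_candidate_le (q ω) hmlk j
  simp only [hcard, true_and]
  have one_sub_le_of_always (h : ∀ ω, (1 - 1 / Real.exp 1 - ε) * optValue f k ≤
      f (slickGreedy (q ω) k H C)) : 1 - δ ≤ P.real {ω | HasComparisonRoom (q ω) k l H →
        (1 - 1 / Real.exp 1 - ε) * optValue f k ≤ f (slickGreedy (q ω) k H C)} := by
    simp only [h, implies_true, Set.ofPred_true, probReal_univ]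
    exact sub_le_self 1 hδ
  rcases le_or_gt (optValue f k) 0 with hW | hW
  · exact one_sub_le_of_always fun ω => mul_optValue_le_of_nonpos hm h0 hW _ _
  rcases le_or_gt (Fintype.card N) k with hN | hN
  · refine one_sub_le_of_always fun ω => (mul_le_of_le_one_left hW.le ?_).trans
      (hH.le_slickGreedy_of_card_le (q ω) hm0 hmlk hN hm)
    linarith [one_div_pos.2 (Real.exp_pos 1)]
  refine one_sub_le_measureReal_of_forall_or (fun ω => ?_) (hbad hN.le hW)
  by_contra! h
  obtain ⟨⟨hroom, hlt⟩, hclose, hcmp⟩ := h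
  exact hlt.not_ge (hH.slickGreedy_approx hC hε hε1 hεm hk hl hmlk hW.le hclose hμ hcmp
    hroom hf hm h0)

end Guarantee

end NoisySubmodular

open NoisySubmodular in
theorem mainTheorem1_general (ε : ℝ) (hε : 0 < ε) (hε1 : ε ≤ 1)
    (D : Measure ℝ) [IsProbabilityMeasure D] (hint : 0 ∈ interior (integrableExpSet id D))
    (hμ : 0 < ∫ x, x ∂D) (hD : FavorsLarger D) :
    ∃ n₀ : ℕ, ∀ n k l m : ℕ, n₀ ≤ n →
      3168 * Real.logb 2 (Real.logb 2 n) / ε ^ 2 ≤ k → l = smoothingSize ε n k → m = numSets ε →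
      ∀ (N : Type*) [Fintype N] [LinearOrder N], Fintype.card N = n →
      ∀ f : Finset N → ℝ, Monotone f → IsSubmodular f → 0 ≤ f ∅ →
      ∀ H : Fin m → Finset N, IsSmoothingFamily H l →
      ∀ C : Finset N → Finset N → Finset N, IsComparisonRule C l →
      1 - 1 / (n : ℝ) ≤
        (noiseLaw N D).real {ξ | HasComparisonRoom (noisyOracle f ξ) k l H →
          #(slickGreedy (noisyOracle f ξ) k H C) ≤ k ∧
          (1 - 1 / Real.exp 1 - ε) * optValue f k ≤ f (slickGreedy (noisyOracle f ξ) k H C)} ∧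
      (2 * k ≤ n → ∀ q : Finset N → ℝ, HasComparisonRoom q k l H) := by
  obtain ⟨u₀, hu₀, reliable⟩ := exists_reliable_threshold hε hε1 hint hμ hD
  refine ⟨⌈(2 : ℝ) ^ u₀⌉₊, fun n k l m hn hk hl hm N _ _ hN f hmono hsub h0 H hH C hC => ?_⟩
  subst hm hN
  have hlogN : u₀ ≤ Real.logb 2 (Fintype.card N) := by
    have hN_pow : (2 : ℝ) ^ u₀ ≤ Fintype.card N := Nat.ceil_le.1 hn
    rwa [Real.le_logb_iff_rpow_le one_lt_two ((by positivity : (0 : ℝ) < 2 ^ u₀).trans_le hN_pow)]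
  have hloglog := one_le_logb_two_logb_two (hu₀.trans hlogN)
  have hk0 : 0 < k := (Nat.cast_pos (α := ℝ)).1 (lt_of_lt_of_le (by positivity) hk)
  have hlk := hl ▸ smoothingSize_le hε (hu₀.trans hlogN) hk
  have hεm := numSets_bounds hε hε1
  have hm0 : 0 < numSets ε := Nat.ceil_pos.2 (by positivity)
  have hmlk : numSets ε * l ≤ k := by
    have := mul_le_of_size_le (numSets ε).cast_nonneg hεm.2 k.cast_nonneg hε.le hlk
    exact_mod_cast this.trans (mul_le_of_le_one_left k.cast_nonneg (by linarith))
  exact ⟨hH.one_sub_le_measureReal_slickGreedy hC hε hε1 hεm hk0 hlk hm0 hmlk hμ hsub hmono h0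
      (by positivity) fun hkN hW => reliable N f k l H C hlogN hk0 hkN hl hmono h0 hW hH,
    fun h2k q => hH.hasComparisonRoom q hmlk hm0 h2k⟩

theorem mainTheorem1 (ε : ℝ) (hε : 0 < ε) (hε1 : ε ≤ 1)
    (D : Measure ℝ) [IsProbabilityMeasure D]
    (hD : NoisySubmodular.HasGeneralizedExponentialTail D)
    (hD' : NoisySubmodular.IsMultiplierLaw D) :
    ∃ n₀ : ℕ, ∀ n k l m : ℕ, n₀ ≤ n →
      3168 * Real.logb 2 (Real.logb 2 n) / ε ^ 2 ≤ k →
      l = NoisySubmodular.smoothingSize ε n k →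
      m = NoisySubmodular.numSets ε →
      ∀ f : Finset (Fin n) → ℝ, Monotone f → NoisySubmodular.IsSubmodular f → 0 ≤ f ∅ →
      ∀ H : Fin m → Finset (Fin n), (∀ i, (H i).card = l) →
        (∀ i j, i ≠ j → Disjoint (H i) (H j)) →
      ∀ C : Finset (Fin n) → Finset (Fin n) → Finset (Fin n),
        (∀ T U, l ≤ (T ∪ U)ᶜ.card → Disjoint (C T U) (T ∪ U) ∧ (C T U).card = l) →
      1 - 1 / (n : ℝ) ≤
        (NoisySubmodular.noiseLaw (Fin n) D).real
          {ξ | NoisySubmodular.HasComparisonRoom (NoisySubmodular.noisyOracle f ξ) k l H →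
            (NoisySubmodular.slickGreedy (NoisySubmodular.noisyOracle f ξ) k H C).card ≤ k ∧
            (1 - 1 / Real.exp 1 - ε) * NoisySubmodular.optValue f k ≤
              f (NoisySubmodular.slickGreedy (NoisySubmodular.noisyOracle f ξ) k H C)} ∧
      (2 * k ≤ n → ∀ ξ : Finset (Fin n) → ℝ,
        NoisySubmodular.HasComparisonRoom (NoisySubmodular.noisyOracle f ξ) k l H) := by
  have hint := hD'.zero_mem_interior_integrableExpSet hD
  obtain ⟨n₀, h⟩ := mainTheorem1_general ε hε hε1 D hint
    (hD'.integral_pos (integrable_of_mem_interior_integrableExpSet hint)) hD'.favorsLarger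
  exact ⟨n₀, fun n k l m hn hk hl hm f hmono hsub h0 H hcard hdisj C hC =>
    (h n k l m hn hk hl hm (Fin n) (Fintype.card_fin n) f hmono hsub h0 H ⟨hcard, hdisj⟩ C
      hC).imp_right fun room h2k _ => room h2k _⟩
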